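/- Let $d\ge 1$ and $\mathcal X=\{1,\dots,k\}$. Let $r:\mathcal X\to[0,\infty)$, let $\sigma(i)$ be an invertible real $d\times d$ matrix for each $i\in\mathcal X$, put $a(i)=\sigma(i)\sigma(i)^*$, and let $\Lambda=(\lambda_{ij})_{k\times k}$ be the rate matrix of a Markov chain on $\mathcal X$ ($\lambda_{ij}\ge 0$ for $i\ne j$, $\sum_j\lambda_{ij}=0$), with $\lambda_i=|\lambda_{ii}|$. Let $T>0$, let $J$ be $(0,T]$ or $[0,T]$, and let $\mathcal K:(0,\infty)^d\to[0,\infty)$ be Lipschitz continuous. Consider the regime-switching system, for $t\in(0,T)$, $s\in(0,\infty)^d$, $i\in\mathcal X$, $$\frac{\partial\phi}{\partial t}+r(i)\sum_{l}s_l\frac{\partial\phi}{\partial s_l}+\frac12\sum_{l,l'}a_{ll'}(i)s_ls_{l'}\frac{\partial^2\phi}{\partial s_l\partial s_{l'}}-r(i)\phi+\sum_{j}\lambda_{ij}\phi(t,s,j)=0,\qquad \phi(T,s,i)=\mathcal K(s).\tag{1}$$ A classical solution with at most linear growth is a solution $\phi$ such that each $\phi(\cdot,\cdot,i)$ is continuous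 on $J\times(0,\infty)^d$ and of class $C^{1,2}$ on $(0,T)\times(0,\infty)^d$, and $|\phi(t,s,i)|\le C(1+\|s\|_1)$ on $(0,T)\times(0,\infty)^d$ for some constant $C$. Let $\eta_i(t,s)=E\big[e^{-r(i)(T-t)}\mathcal K(Y(T))\,\big|\,Y(t)=s\big]$, where $Y$ is the geometric Brownian motion $dY_l=Y_l\big(r(i)\,dt+\sum_j\sigma_{l,j}(i)\,dW^j\big)$, and for $v>0$ let $\alpha(\cdot,s,i,v)$ be the lognormal density $$\alpha(x,s,i,v)=\frac{\exp\big[-\frac12\sum_{l,l'}(\mathfrak S^{-1})_{ll'}(z_l-\tilde z_l)(z_{l'}-\tilde z_{l'})\big]}{\sqrt{(2\pi)^d\det\mathfrak S}\;x_1\cdots x_d},\quad \mathfrak S=v\,a(i),\quad z_l=\ln\frac{x_l}{s_l},\quad \tilde z_l=\Big(r(i)-\tfrac12a_{ll}(i)\Big)v.$$ **Proposition.** Every classical solution $\phi$ of (1) with at most linear growth satisfies the integral equation $$\phi(t,s,i)=e^{-\lambda_i(T-t)}\eta_i(t,s)+\int_0^{T-t}e^{-(\lambda_i+r(i))v}\sum_{j\ne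 i}\lambda_{ij}\int_{(0,\infty)^d}\phi(t+v,x,j)\,\alpha(x,s,i,v)\,dx\,dv\tag{IE}$$ for all $t\in J$, $s\in(0,\infty)^d$, $i\in\mathcal X$, where the integrals (and the expectation defining $\eta_i$) converge absolutely. The same holds if the $\eta_i$ in (IE) are replaced by any classical solutions, with at most linear growth and on the same $J$, of the Black-Scholes-Merton problems $$\frac{\partial\eta_i}{\partial t}+r(i)\sum_l s_l\frac{\partial\eta_i}{\partial s_l}+\frac12\sum_{l,l'}a_{ll'}(i)s_ls_{l'}\frac{\partial^2\eta_i}{\partial s_l\partial s_{l'}}=r(i)\eta_i,\qquad \eta_i(T,s)=\mathcal K(s).$$ -/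

import Mathlib

open MeasureTheory Set

noncomputable section

namespace RegimeSwitching

/-- Coefficients of the system of PDEs with `d` stocks and regimes `1, …, k`: the interest rates
`r`, the volatility matrices `σ`, and the rate matrix `rate` (with entries `λᵢⱼ`) of the Markov
chain. -/
structure Market (d k : ℕ) where
  /-- interest rate in each regime -/
  r : Fin k → ℝ
  /-- volatility matrix in each regime -/
  σ : Fin k → Matrix (Fin d) (Fin d) ℝ
  /-- instantaneous transition rates -/
  rate : Matrix (Fin k) (Fin k) ℝ
  r_nonneg : ∀ i, 0 ≤ r i
  isUnit_σ : ∀ i, IsUnit (σ i)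
  rate_nonneg : ∀ i j, i ≠ j → 0 ≤ rate i j
  rate_row_sum : ∀ i, ∑ j, rate i j = 0

/-- The open positive orthant `(0, ∞)^d`. -/
def orthant (d : ℕ) : Set (Fin d → ℝ) := {s | ∀ l, 0 < s l}

/-- The partial derivative of `f` in the `l`-th coordinate, at `s`. -/
def partialDeriv {d : ℕ} (l : Fin d) (f : (Fin d → ℝ) → ℝ) (s : Fin d → ℝ) : ℝ :=
  lineDeriv ℝ f s (Pi.single l 1)

/-- `f (t, s)` is of class `C^{1,2}` on `(0, T) × (0, ∞)^d`: the derivatives `∂f/∂t`, `∂f/∂s_l` and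
`∂²f/∂s_l∂s_l'` exist and are jointly continuous there. (Continuity of `f` itself is part of
`IsClassical`.) -/
structure IsC12 {d : ℕ} (T : ℝ) (f : ℝ → (Fin d → ℝ) → ℝ) : Prop where
  diff_t : ∀ t ∈ Ioo 0 T, ∀ s ∈ orthant d, DifferentiableAt ℝ (fun u => f u s) t
  cont_t : ContinuousOn (fun p : ℝ × (Fin d → ℝ) => deriv (fun u => f u p.2) p.1)
    (Ioo 0 T ×ˢ orthant d)
  diff_s : ∀ t ∈ Ioo 0 T, ∀ s ∈ orthant d, ∀ l : Fin d,
    LineDifferentiableAt ℝ (f t) s (Pi.single l 1)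
  cont_s : ∀ l : Fin d, ContinuousOn (fun p : ℝ × (Fin d → ℝ) => partialDeriv l (f p.1) p.2)
    (Ioo 0 T ×ˢ orthant d)
  diff_ss : ∀ t ∈ Ioo 0 T, ∀ s ∈ orthant d, ∀ l l' : Fin d,
    LineDifferentiableAt ℝ (partialDeriv l' (f t)) s (Pi.single l 1)
  cont_ss : ∀ l l' : Fin d,
    ContinuousOn (fun p : ℝ × (Fin d → ℝ) => partialDeriv l (partialDeriv l' (f p.1)) p.2)
      (Ioo 0 T ×ˢ orthant d)

/-- The regularity of a classical solution on the time interval `J` (which is `(0, T]` or `[0, T]`):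
continuous on `J × (0, ∞)^d` and of class `C^{1,2}` on `(0, T) × (0, ∞)^d`. -/
structure IsClassical {d : ℕ} (T : ℝ) (J : Set ℝ) (f : ℝ → (Fin d → ℝ) → ℝ) : Prop where
  cont : ContinuousOn (fun p : ℝ × (Fin d → ℝ) => f p.1 p.2) (J ×ˢ orthant d)
  c12 : IsC12 T f

/-- At most linear growth in the space variable, uniformly in time. -/
def LinearGrowth {d : ℕ} (T : ℝ) (f : ℝ → (Fin d → ℝ) → ℝ) : Prop :=
  ∃ C : ℝ, ∀ t ∈ Ioo 0 T, ∀ s ∈ orthant d, |f t s| ≤ C * (1 + ∑ l, |s l|)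

namespace Market

variable {d k : ℕ} (M : Market d k)

/-- The diffusion matrix `a(i) = σ(i) σ(i)ᵀ`. -/
def a (i : Fin k) : Matrix (Fin d) (Fin d) ℝ := M.σ i * (M.σ i).transpose

/-- `λᵢ = |λᵢᵢ|`, the total jump rate out of the state `i`. -/
def exitRate (i : Fin k) : ℝ := |M.rate i i|

/-- The Black-Scholes-Merton operator of regime `i`, including the discounting term. -/
def bsmOp (i : Fin k) (f : (Fin d → ℝ) → ℝ) (s : Fin d → ℝ) : ℝ :=
  M.r i * ∑ l, s l * partialDeriv l f s
    + (1 / 2) * ∑ l, ∑ l', M.a i l l' * s l * s l' * partialDeriv l (partialDeriv l' f) s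
    - M.r i * f s

/-- The operator `𝕃` of the coupled system, acting on the space and regime variables. -/
def genOp (f : (Fin d → ℝ) → Fin k → ℝ) (s : Fin d → ℝ) (i : Fin k) : ℝ :=
  M.bsmOp i (fun y => f y i) s + ∑ j, M.rate i j * f s j

/-- `φ` is a classical solution, of at most linear growth, of the regime-switching system
`∂φ/∂t + 𝕃φ = 0` on `(0, T) × (0, ∞)^d × {1, …, k}`, with `φ(T, ·, i) = K`. -/
structure IsSystemSolution (T : ℝ) (J : Set ℝ) (K : (Fin d → ℝ) → ℝ)
    (φ : ℝ → (Fin d → ℝ) → Fin k → ℝ) : Prop where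
  classical : ∀ i, IsClassical T J (fun t s => φ t s i)
  growth : ∀ i, LinearGrowth T (fun t s => φ t s i)
  pde : ∀ t ∈ Ioo 0 T, ∀ s ∈ orthant d, ∀ i,
    deriv (fun u => φ u s i) t + M.genOp (φ t) s i = 0
  terminal : ∀ s ∈ orthant d, ∀ i, φ T s i = K s

/-- `u` is a classical solution, of at most linear growth, of the Black-Scholes-Merton terminal
value problem of the single regime `i`, with terminal value `K`. -/
structure IsBSMSolution (T : ℝ) (J : Set ℝ) (K : (Fin d → ℝ) → ℝ) (i : Fin k)
    (u : ℝ → (Fin d → ℝ) → ℝ) : Prop where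
  classical : IsClassical T J u
  growth : LinearGrowth T u
  pde : ∀ t ∈ Ioo 0 T, ∀ s ∈ orthant d, deriv (fun τ => u τ s) t + M.bsmOp i (u t) s = 0
  terminal : ∀ s ∈ orthant d, u T s = K s

/-- The value after a time `v` of the geometric Brownian motion
`dY_l = Y_l (r(i) dt + ∑ⱼ σ_{l,j}(i) dWʲ)` started from `s`, when `w` is the increment of the
Brownian motion `W` over that time. -/
def gbm (i : Fin k) (v : ℝ) (s w : Fin d → ℝ) : Fin d → ℝ := fun l =>
  s l * Real.exp ((M.r i - (1 / 2) * M.a i l l) * v + ∑ j, M.σ i l j * w j)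

/-- The law of the increment of a standard `d`-dimensional Brownian motion over a time `v ≥ 0`. -/
def brownianIncrement (d : ℕ) (v : ℝ) : Measure (Fin d → ℝ) :=
  Measure.pi fun _ => ProbabilityTheory.gaussianReal 0 v.toNNReal

/-- `ηᵢ(t, s) = E[exp(-r(i) (T - t)) K(Y(T)) | Y(t) = s]`, for the geometric Brownian motion `Y` of
regime `i`. -/
def eta (T : ℝ) (K : (Fin d → ℝ) → ℝ) (i : Fin k) (t : ℝ) (s : Fin d → ℝ) : ℝ :=
  ∫ w, Real.exp (-M.r i * (T - t)) * K (M.gbm i (T - t) s w) ∂brownianIncrement d (T - t)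

/-- The lognormal density `α(x, s, i, v)`. -/
def alpha (x s : Fin d → ℝ) (i : Fin k) (v : ℝ) : ℝ :=
  let S : Matrix (Fin d) (Fin d) ℝ := v • M.a i
  let z : Fin d → ℝ := fun l => Real.log (x l / s l)
  let z' : Fin d → ℝ := fun l => (M.r i - (1 / 2) * M.a i l l) * v
  Real.exp (-(1 / 2) * ∑ l, ∑ l', S⁻¹ l l' * (z l - z' l) * (z l' - z' l'))
    / (Real.sqrt ((2 * Real.pi) ^ d * S.det) * ∏ l, x l)

/-- The integrand, in the jump time variable `v`, of the integral equation. -/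
def jumpIntegrand (φ : ℝ → (Fin d → ℝ) → Fin k → ℝ) (t : ℝ) (s : Fin d → ℝ) (i : Fin k)
    (v : ℝ) : ℝ :=
  Real.exp (-(M.exitRate i + M.r i) * v) *
    ∑ j ∈ Finset.univ.erase i, M.rate i j *
      ∫ x in orthant d, φ (t + v) x j * M.alpha x s i v

/-- `φ` solves the integral equation with data `η` at all times of `J`: the integrals
converge absolutely, and the equation holds. -/
def SolvesIE (T : ℝ) (J : Set ℝ) (η : Fin k → ℝ → (Fin d → ℝ) → ℝ)
    (φ : ℝ → (Fin d → ℝ) → Fin k → ℝ) : Prop :=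
  ∀ t ∈ J, ∀ s ∈ orthant d, ∀ i,
    (∀ v ∈ Ioc 0 (T - t), ∀ j, j ≠ i →
      IntegrableOn (fun x => φ (t + v) x j * M.alpha x s i v) (orthant d)) ∧
    IntervalIntegrable (M.jumpIntegrand φ t s i) volume 0 (T - t) ∧
    φ t s i = Real.exp (-M.exitRate i * (T - t)) * η i t s
      + ∫ v in 0..(T - t), M.jumpIntegrand φ t s i v

end Market

end RegimeSwitching

end

open Filter Topology ProbabilityTheory

noncomputable section

namespace RegimeSwitching

/-! The proof is a Feynman-Kac argument made without stochastic calculus. In the equation of regime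
`i` the diagonal rate is `-λᵢ`, so it can be joined to the discount rate, and the other regimes are
treated as a known source `g = ∑_{j ≠ i} λᵢⱼ φ(·, ·, j)`. Thus `φ(·, ·, i)` solves a scalar backward
equation with killing rate `c = λᵢ + r(i)`, and (IE) is the Feynman-Kac representation of its
solution.

Fix `(t, s)`. The geometric Brownian motion is an explicit function `gbm v s w` of the Brownian
increment `w`. With `U(v, w) = exp(-c v) f(t + v, gbm v s w)`, and `G` made likewise from `g`, the
equation becomes the heat equation `∂U/∂v + ½ ΔU = -G` (`isHeatData_pullback`); the Itô term `-½
a_ll` in the exponent cancels the first-order part of the Laplacian. Linear growth in `s` becomes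
exponential growth in `w`, which Gaussian measures integrate.

For standard Gaussian `Z`, differentiating `E U(v, √v Z)` in `v` gives, besides `-E G - ½ E ΔU`, the
term `E[Z · ∇U] / (2√v)`, which equals `½ E ΔU` by Gaussian integration by parts. So formally the
derivative is `-E G`. No growth bound on the derivatives of `U` is known. Hence `U` is multiplied by
a cutoff, all derivatives are moved onto the cutoff (`integral_cutoff_generator`), the identity is
integrated in time (`integral_cutoff_sub`), and the cutoff is removed by dominated convergence
(`integral_sub_integral`). This works on `0 < v₁ ≤ v₂ < S`; continuity reaches `v = 0` and `v = S`
(`eq_integral_add`).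

Finally, Gaussian integrals become integrals against the lognormal density by the change of
variables `z ↦ gbm v s (√v z)` (`integral_mul_alpha`). The same representation with zero source and
`c = r(i)` identifies every classical Black-Scholes-Merton solution with `eta`, which gives the last
claim. -/

/-! ### Differentiability from continuous partial derivatives -/

/-- A function whose derivatives along a spanning family of directions exist near a point and are
continuous at it is Fréchet differentiable there. -/
theorem hasFDerivAt_of_continuousAt_lineDeriv {E ι : Type*} [NormedAddCommGroup E]
    [NormedSpace ℝ E] [Fintype ι] (e : ι → E) (c : ι → E →L[ℝ] ℝ)
    (hec : ∀ x, ∑ i, c i x • e i = x) {f : E → ℝ} {f' : ι → E → ℝ} {x : E}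
    (hf : ∀ i, ∀ᶠ y in 𝓝 x, HasLineDerivAt ℝ f (f' i y) y (e i))
    (hf' : ∀ i, ContinuousAt (f' i) x) :
    HasFDerivAt f (∑ i, f' i x • c i) x := by
  classical
  -- The path from `x` to `x + h` moves one coordinate at a time; `A` is the set of coordinates
  -- already moved.
  have key : ∀ A : Finset ι, (fun h : E => f (x + ∑ i ∈ A, c i h • e i) - f x
      - ∑ i ∈ A, f' i x * c i h) =o[𝓝 0] (fun h => h) := by
    intro A
    induction A using Finset.induction_on with
    | empty => simp
    | insert m A hm ih =>
      have step : (fun h : E => f (x + ∑ i ∈ A, c i h • e i + c m h • e m)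
          - f (x + ∑ i ∈ A, c i h • e i) - f' m x * c m h) =o[𝓝 0] (fun h => h) := by
        have hO : (fun h : E => c m h) =O[𝓝 0] (fun h => h) := (c m).isBigO_id _
        refine Asymptotics.IsLittleO.trans_isBigO ?_ hO
        rw [Asymptotics.isLittleO_iff]
        intro ε hε
        have hev : ∀ᶠ y in 𝓝 x, HasLineDerivAt ℝ f (f' m y) y (e m) ∧ |f' m y - f' m x| ≤ ε := by
          refine (hf m).and ?_
          filter_upwards [(hf' m).eventually (Metric.ball_mem_nhds _ hε)] with y hy
          exact (Real.dist_eq _ _ ▸ (Metric.mem_ball.1 hy)).le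
        obtain ⟨δ, hδ, hball⟩ := Metric.eventually_nhds_iff.1 hev
        have ht : Tendsto (fun h : E => (∑ i ∈ A, ‖c i h • e i‖) + ‖c m h • e m‖) (𝓝 0) (𝓝 0) := by
          have : Continuous (fun h : E => (∑ i ∈ A, ‖c i h • e i‖) + ‖c m h • e m‖) := by
            fun_prop
          simpa using this.tendsto 0
        filter_upwards [ht.eventually (gt_mem_nhds hδ)] with h hh
        -- After the linear term is subtracted, the derivative along the segment is at most `ε * |c
        -- m h|`, so the mean value inequality gives the little-o estimate.
        have hseg : ∀ τ ∈ Icc (0 : ℝ) 1, HasDerivWithinAt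
            (fun τ : ℝ => f (x + ∑ i ∈ A, c i h • e i + (τ * c m h) • e m) - τ * (f' m x * c m h))
            ((f' m (x + ∑ i ∈ A, c i h • e i + (τ * c m h) • e m) - f' m x) * c m h)
            (Icc 0 1) τ ∧
            |f' m (x + ∑ i ∈ A, c i h • e i + (τ * c m h) • e m) - f' m x| ≤ ε := by
          intro τ hτ
          have hd : dist (x + ∑ i ∈ A, c i h • e i + (τ * c m h) • e m) x < δ := by
            refine lt_of_le_of_lt ?_ hh
            rw [dist_eq_norm, add_assoc, add_sub_cancel_left]
            refine (norm_add_le _ _).trans (add_le_add (norm_sum_le _ _) ?_)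
            rw [mul_smul, norm_smul]
            refine mul_le_of_le_one_left (norm_nonneg _) ?_
            rw [Real.norm_eq_abs, abs_of_nonneg hτ.1]
            exact hτ.2
          obtain ⟨h1, h2⟩ := hball hd
          refine ⟨HasDerivAt.hasDerivWithinAt ?_, h2⟩
          have h3 : HasDerivAt (fun u : ℝ => (u - τ) * c m h) (c m h) τ := by
            simpa using ((hasDerivAt_id τ).sub_const τ).mul_const (c m h)
          have h4 := HasDerivAt.comp_of_eq τ (h₂ := fun t : ℝ =>
            f (x + ∑ i ∈ A, c i h • e i + (τ * c m h) • e m + t • e m)) h1 h3 (by simp)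
          have h5 : ((fun t : ℝ => f (x + ∑ i ∈ A, c i h • e i + (τ * c m h) • e m + t • e m)) ∘
              fun u : ℝ => (u - τ) * c m h) =
              fun u => f (x + ∑ i ∈ A, c i h • e i + (u * c m h) • e m) := by
            funext u
            simp only [Function.comp]
            congr 1
            rw [add_assoc _ ((τ * c m h) • e m), ← add_smul]
            congr 2
            ring
          rw [h5] at h4
          refine (h4.sub ((hasDerivAt_id τ).mul_const (f' m x * c m h))).congr_deriv ?_
          ring
        have hmv := (convex_Icc (0 : ℝ) 1).norm_image_sub_le_of_norm_hasDerivWithin_le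
          (C := ε * ‖c m h‖) (fun τ hτ => (hseg τ hτ).1) (fun τ hτ => by
            rw [norm_mul]
            exact mul_le_mul_of_nonneg_right (hseg τ hτ).2 (norm_nonneg _))
          (left_mem_Icc.2 zero_le_one) (right_mem_Icc.2 zero_le_one)
        simp only [one_mul, zero_mul, zero_smul, add_zero, sub_zero, norm_one, mul_one] at hmv
        rwa [sub_right_comm] at hmv
      refine (ih.add step).congr_left fun h => ?_
      rw [Finset.sum_insert hm, Finset.sum_insert hm, add_comm (c m h • e m), ← add_assoc]
      ring
  rw [hasFDerivAt_iff_isLittleO_nhds_zero]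
  refine (key Finset.univ).congr_left fun h => ?_
  rw [hec]
  simp

/-! ### Gaussian measure and integration by parts -/

/-- The standard Gaussian measure on `ℝ^d`. -/
def stdGaussianPi (d : ℕ) : Measure (Fin d → ℝ) := Measure.pi fun _ => gaussianReal 0 1

instance (d : ℕ) : IsProbabilityMeasure (stdGaussianPi d) := by
  unfold stdGaussianPi; infer_instance

/-- The density of the standard Gaussian measure on `ℝ^d`. -/
def stdGaussianDensity (d : ℕ) (z : Fin d → ℝ) : ℝ := ∏ l, gaussianPDFReal 0 1 (z l)

theorem stdGaussianDensity_nonneg {d : ℕ} (z : Fin d → ℝ) : 0 ≤ stdGaussianDensity d z :=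
  Finset.prod_nonneg fun _ _ => gaussianPDFReal_nonneg _ _ _

theorem continuous_stdGaussianDensity (d : ℕ) : Continuous (stdGaussianDensity d) := by
  unfold stdGaussianDensity gaussianPDFReal
  fun_prop

theorem stdGaussianPi_eq_withDensity (d : ℕ) :
    stdGaussianPi d = volume.withDensity fun z => ENNReal.ofReal (stdGaussianDensity d z) := by
  refine Measure.pi_eq fun s hs => ?_
  rw [withDensity_apply _ (MeasurableSet.univ_pi hs)]
  have hint : Integrable (stdGaussianDensity d) :=
    Integrable.fintype_prod fun _ => integrable_gaussianPDFReal 0 1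
  rw [← ofReal_integral_eq_lintegral_ofReal hint.restrict
    (ae_of_all _ fun z => stdGaussianDensity_nonneg z), volume_pi, Measure.restrict_pi_pi]
  unfold stdGaussianDensity
  rw [integral_fintype_prod_eq_prod (f := fun _ : Fin d => gaussianPDFReal 0 1),
    ENNReal.ofReal_prod_of_nonneg fun i _ => integral_nonneg (gaussianPDFReal_nonneg _ _)]
  refine Finset.prod_congr rfl fun i _ => ?_
  rw [gaussianReal_apply_eq_integral _ one_ne_zero]

theorem integral_stdGaussianPi {d : ℕ} (f : (Fin d → ℝ) → ℝ) :
    ∫ z, f z ∂stdGaussianPi d = ∫ z, stdGaussianDensity d z * f z := by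
  rw [stdGaussianPi_eq_withDensity, integral_withDensity_eq_integral_toReal_smul
    (continuous_stdGaussianDensity d).measurable.ennreal_ofReal
    (ae_of_all _ fun _ => ENNReal.ofReal_lt_top)]
  simp [ENNReal.toReal_ofReal, stdGaussianDensity_nonneg]

theorem integrable_stdGaussianPi_iff {d : ℕ} (f : (Fin d → ℝ) → ℝ) :
    Integrable f (stdGaussianPi d) ↔ Integrable fun z => stdGaussianDensity d z * f z := by
  rw [stdGaussianPi_eq_withDensity, integrable_withDensity_iff_integrable_smul'
    (continuous_stdGaussianDensity d).measurable.ennreal_ofReal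
    (ae_of_all _ fun _ => ENNReal.ofReal_lt_top)]
  simp [ENNReal.toReal_ofReal, stdGaussianDensity_nonneg]

theorem hasLineDerivAt_stdGaussianDensity {d : ℕ} (z : Fin d → ℝ) (j : Fin d) :
    HasLineDerivAt ℝ (stdGaussianDensity d) (-(z j * stdGaussianDensity d z)) z
      (Pi.single j 1) := by
  have h : stdGaussianDensity d = fun z : Fin d → ℝ =>
      ((√(2 * Real.pi * (1 : NNReal)))⁻¹) ^ d * Real.exp (-∑ l, z l ^ 2 / 2) := by
    funext z
    simp [stdGaussianDensity, gaussianPDFReal, Finset.prod_mul_distrib, ← Real.exp_sum, neg_div]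
  rw [h]
  have h1 : HasFDerivAt (fun z : Fin d → ℝ => ∑ l, z l ^ 2 / 2)
      (∑ l, z l • ContinuousLinearMap.proj (R := ℝ) (φ := fun _ : Fin d => ℝ) l) z := by
    refine HasFDerivAt.fun_sum fun l _ => ?_
    have h2 : HasFDerivAt (fun z : Fin d → ℝ => z l)
      (ContinuousLinearMap.proj (R := ℝ) (φ := fun _ : Fin d => ℝ) l) z := hasFDerivAt_apply l z
    have h3 := (h2.pow 2).mul_const (1 / 2 : ℝ)
    refine (h3.congr_fderiv ?_).congr_of_eventuallyEq (Eventually.of_forall fun y => ?_)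
    · ext y
      simp
      ring
    · simp
      ring
  have h4 := ((h1.neg.exp).const_mul
    (((√(2 * Real.pi * (1 : NNReal)))⁻¹) ^ d)).hasLineDerivAt (Pi.single j 1)
  refine h4.congr_deriv ?_
  simp [Pi.single_apply]
  ring

/-- Gaussian integration by parts for compactly supported functions. -/
theorem integral_lineDeriv_stdGaussianPi {d : ℕ} {f f' : (Fin d → ℝ) → ℝ} (j : Fin d)
    (hf : Continuous f) (hf' : Continuous f') (hsf : HasCompactSupport f)
    (hsf' : HasCompactSupport f')
    (hd : ∀ z, HasLineDerivAt ℝ f (f' z) z (Pi.single j 1)) :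
    ∫ z, f' z ∂stdGaussianPi d = ∫ z, z j * f z ∂stdGaussianPi d := by
  have hρ := continuous_stdGaussianDensity d
  have key := integral_bilinear_hasLineDerivAt_right_eq_neg_left_of_integrable
    (μ := (volume : Measure (Fin d → ℝ))) (f := f) (f' := f') (g := stdGaussianDensity d)
    (g' := fun z => -(z j * stdGaussianDensity d z)) (v := Pi.single j 1)
    (B := ContinuousLinearMap.mul ℝ ℝ)
    ((hf'.mul hρ).integrable_of_hasCompactSupport hsf'.mul_right)
    (Continuous.integrable_of_hasCompactSupport (by simp; fun_prop) hsf.mul_right)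
    ((hf.mul hρ).integrable_of_hasCompactSupport hsf.mul_right)
    (fun z _ => hd z) (fun z _ => hasLineDerivAt_stdGaussianDensity z j)
  simp only [ContinuousLinearMap.mul_apply', mul_neg, integral_neg, neg_inj] at key
  rw [integral_stdGaussianPi, integral_stdGaussianPi]
  simp only [mul_comm (stdGaussianDensity d _)] at *
  rw [← key]
  congr with z
  ring

/-- The source of all dominating functions below. The exponential splits into one factor per
coordinate, and `exp (κ|x|) ≤ exp (κx) + exp (-κx)`. -/
theorem integrable_exp_sum_abs (d : ℕ) (κ : ℝ) :
    Integrable (fun z : Fin d → ℝ => Real.exp (κ * ∑ l, |z l|)) (stdGaussianPi d) := by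
  have h1 : Integrable (fun x : ℝ => Real.exp (κ * |x|)) (gaussianReal 0 1) := by
    refine ((integrable_exp_mul_gaussianReal κ).add (integrable_exp_mul_gaussianReal (-κ))).mono'
      (by fun_prop) (ae_of_all _ fun x => ?_)
    rw [Real.norm_eq_abs, abs_of_pos (Real.exp_pos _)]
    rcases abs_cases x with ⟨h, -⟩ | ⟨h, -⟩ <;> rw [h] <;>
      simp [(Real.exp_pos _).le]
  have h2 : Integrable (fun z : Fin d → ℝ => ∏ l, Real.exp (κ * |z l|))
      (Measure.pi fun _ => gaussianReal 0 1) := Integrable.fintype_prod fun _ => h1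
  simpa [stdGaussianPi, Finset.mul_sum, Real.exp_sum] using h2

/-! ### Cutoff functions -/

/-- A compactly supported function on `ℝ^d` bounded by `1`, together with its first and pure second
partial derivatives, which are bounded by `B`. -/
structure IsCutoff {d : ℕ} (B : ℝ) (χ : (Fin d → ℝ) → ℝ) (χ₁ χ₂ : Fin d → (Fin d → ℝ) → ℝ) :
    Prop where
  cont : Continuous χ
  cont₁ : ∀ j, Continuous (χ₁ j)
  cont₂ : ∀ j, Continuous (χ₂ j)
  supp : HasCompactSupport χ
  supp₁ : ∀ j, HasCompactSupport (χ₁ j)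
  supp₂ : ∀ j, HasCompactSupport (χ₂ j)
  deriv₁ : ∀ j w, HasLineDerivAt ℝ χ (χ₁ j w) w (Pi.single j 1)
  deriv₂ : ∀ j w, HasLineDerivAt ℝ (χ₁ j) (χ₂ j w) w (Pi.single j 1)
  bound : ∀ w, |χ w| ≤ 1
  bound₁ : ∀ j w, |χ₁ j w| ≤ B
  bound₂ : ∀ j w, |χ₂ j w| ≤ B
  nonneg_B : 0 ≤ B

theorem exists_isCutoff (d : ℕ) : ∃ (B : ℝ) (χ : (Fin d → ℝ) → ℝ)
    (χ₁ χ₂ : Fin d → (Fin d → ℝ) → ℝ), IsCutoff B χ χ₁ χ₂ ∧ ∀ᶠ w in 𝓝 0, χ w = 1 := by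
  let f : ContDiffBump (0 : Fin d → ℝ) := ⟨1, 2, one_pos, one_lt_two⟩
  let f₁ : Fin d → (Fin d → ℝ) → ℝ := fun j w => fderiv ℝ f w (Pi.single j 1)
  let f₂ : Fin d → (Fin d → ℝ) → ℝ := fun j w => fderiv ℝ (f₁ j) w (Pi.single j 1)
  have hf : ContDiff ℝ 2 f := f.contDiff
  have hf₁ : ∀ j, ContDiff ℝ 1 (f₁ j) := fun j =>
    (hf.fderiv_right (m := 1) (by norm_num)).clm_apply contDiff_const
  have hf₂ : ∀ j, Continuous (f₂ j) := fun j =>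
    ((hf₁ j).continuous_fderiv one_ne_zero).clm_apply continuous_const
  have hs : HasCompactSupport f := f.hasCompactSupport
  have hs₁ : ∀ j, HasCompactSupport (f₁ j) := fun j => hs.fderiv_apply (𝕜 := ℝ) _
  have hs₂ : ∀ j, HasCompactSupport (f₂ j) := fun j => (hs₁ j).fderiv_apply (𝕜 := ℝ) _
  have h1 : ∀ j, ∃ C, ∀ w, |f₁ j w| ≤ C := fun j =>
    (hs₁ j).exists_bound_of_continuous (hf₁ j).continuous
  have h2 : ∀ j, ∃ C, ∀ w, |f₂ j w| ≤ C := fun j => (hs₂ j).exists_bound_of_continuous (hf₂ j)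
  choose C₁ hC₁ using h1
  choose C₂ hC₂ using h2
  have hle : ∀ j, |C₁ j| + |C₂ j| ≤ ∑ i, (|C₁ i| + |C₂ i|) := fun j =>
    Finset.single_le_sum (f := fun i => |C₁ i| + |C₂ i|) (fun i _ => by positivity)
      (Finset.mem_univ j)
  refine ⟨∑ i, (|C₁ i| + |C₂ i|), f, f₁, f₂, ⟨f.continuous, fun j => (hf₁ j).continuous, hf₂, hs,
    hs₁, hs₂, fun j w => ?_, fun j w => ?_, fun w => ?_, fun j w => ?_, fun j w => ?_, ?_⟩, ?_⟩
  · exact (hf.differentiable two_ne_zero w).hasFDerivAt.hasLineDerivAt _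
  · exact ((hf₁ j).differentiable one_ne_zero w).hasFDerivAt.hasLineDerivAt _
  · rw [abs_of_nonneg f.nonneg]
    exact f.le_one
  · have := le_abs_self (C₁ j)
    have := abs_nonneg (C₂ j)
    linarith [hC₁ j w, hle j]
  · have := le_abs_self (C₂ j)
    have := abs_nonneg (C₁ j)
    linarith [hC₂ j w, hle j]
  · positivity
  · exact f.eventuallyEq_one

theorem hasLineDerivAt_comp_smul {d : ℕ} {f : (Fin d → ℝ) → ℝ} {f' c : ℝ} {w v : Fin d → ℝ}
    (h : HasLineDerivAt ℝ f f' (c • w) v) :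
    HasLineDerivAt ℝ (fun w => f (c • w)) (c * f') w v := by
  have h1 : HasDerivAt (fun t : ℝ => c * t) c 0 := by
    simpa using (hasDerivAt_id (0 : ℝ)).const_mul c
  have h2 := HasDerivAt.comp_of_eq (0 : ℝ) (h₂ := fun t : ℝ => f (c • w + t • v)) h h1 (by simp)
  refine (h2.congr_of_eventuallyEq (Eventually.of_forall fun t => ?_)).congr_deriv (mul_comm _ _)
  simp [mul_smul]

theorem hasLineDerivAt_mul {d : ℕ} {f g : (Fin d → ℝ) → ℝ} {f' g' : ℝ} {w v : Fin d → ℝ}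
    (hf : HasLineDerivAt ℝ f f' w v) (hg : HasLineDerivAt ℝ g g' w v) :
    HasLineDerivAt ℝ (fun w => f w * g w) (f' * g w + f w * g') w v := by
  have h : HasDerivAt (fun t : ℝ => f (w + t • v) * g (w + t • v))
      (f' * g (w + (0 : ℝ) • v) + f (w + (0 : ℝ) • v) * g') 0 := HasDerivAt.fun_mul hf hg
  simp only [zero_smul, add_zero] at h
  exact h

theorem HasCompactSupport.comp_const_smul {d : ℕ} {f : (Fin d → ℝ) → ℝ} (hf : HasCompactSupport f)
    {c : ℝ} (hc : c ≠ 0) : HasCompactSupport fun w => f (c • w) :=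
  hf.comp_homeomorph (Homeomorph.smulOfNeZero c hc)

/-- Each derivative of the dilated cutoff gains a factor `c ≤ 1`, so the same `B` serves every
dilation; this makes the later domination uniform. -/
theorem IsCutoff.comp_smul {d : ℕ} {B : ℝ} {χ : (Fin d → ℝ) → ℝ}
    {χ₁ χ₂ : Fin d → (Fin d → ℝ) → ℝ} (h : IsCutoff B χ χ₁ χ₂) {c : ℝ} (hc : 0 < c) (hc1 : c ≤ 1) :
    IsCutoff B (fun w => χ (c • w)) (fun j w => c * χ₁ j (c • w))
      (fun j w => c * (c * χ₂ j (c • w))) where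
  cont := h.cont.comp (by fun_prop)
  cont₁ j := continuous_const.mul ((h.cont₁ j).comp (by fun_prop))
  cont₂ j := continuous_const.mul (continuous_const.mul ((h.cont₂ j).comp (by fun_prop)))
  supp := HasCompactSupport.comp_const_smul h.supp hc.ne'
  supp₁ j := (HasCompactSupport.comp_const_smul (h.supp₁ j) hc.ne').mul_left
  supp₂ j := ((HasCompactSupport.comp_const_smul (h.supp₂ j) hc.ne').mul_left).mul_left
  deriv₁ j w := hasLineDerivAt_comp_smul (h.deriv₁ j _)
  deriv₂ j w := HasDerivAt.const_mul c (hasLineDerivAt_comp_smul (h.deriv₂ j (c • w)))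
  bound w := h.bound _
  bound₁ j w := by
    rw [abs_mul, abs_of_pos hc]
    exact (mul_le_of_le_one_left (abs_nonneg _) hc1).trans (h.bound₁ j _)
  bound₂ j w := by
    rw [abs_mul, abs_mul, abs_of_pos hc]
    exact (mul_le_of_le_one_left (by positivity) hc1).trans
      ((mul_le_of_le_one_left (abs_nonneg _) hc1).trans (h.bound₂ j _))
  nonneg_B := h.nonneg_B

theorem IsCutoff.exists_radius {d : ℕ} {B : ℝ} {χ : (Fin d → ℝ) → ℝ}
    {χ₁ χ₂ : Fin d → (Fin d → ℝ) → ℝ} (h : IsCutoff B χ χ₁ χ₂) :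
    ∃ r, 0 < r ∧ ∀ w, r ≤ ‖w‖ → χ w = 0 ∧ (∀ j, χ₁ j w = 0) ∧ ∀ j, χ₂ j w = 0 := by
  obtain ⟨r₀, hr₀, h₀⟩ := h.supp.exists_pos_le_norm
  choose r₁ hr₁ h₁ using fun j => (h.supp₁ j).exists_pos_le_norm
  choose r₂ hr₂ h₂ using fun j => (h.supp₂ j).exists_pos_le_norm
  have hle : ∀ j, r₁ j + r₂ j ≤ ∑ i, (r₁ i + r₂ i) := fun j =>
    Finset.single_le_sum (f := fun i => r₁ i + r₂ i)
      (fun i _ => add_nonneg (hr₁ i).le (hr₂ i).le) (Finset.mem_univ j)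
  have hpos : 0 ≤ ∑ i, (r₁ i + r₂ i) :=
    Finset.sum_nonneg fun i _ => add_nonneg (hr₁ i).le (hr₂ i).le
  exact ⟨r₀ + ∑ i, (r₁ i + r₂ i), by positivity, fun w hw => ⟨h₀ w (by linarith),
    fun j => h₁ j w (by linarith [hle j, hr₂ j]), fun j => h₂ j w (by linarith [hle j, hr₁ j])⟩⟩

/-- Integration by parts turning the drift of `v ↦ χ u (√v z)` into half of the Laplacian. -/
theorem integral_cutoff_generator {d : ℕ} {B : ℝ} {χ : (Fin d → ℝ) → ℝ}
    {χ₁ χ₂ : Fin d → (Fin d → ℝ) → ℝ} (h : IsCutoff B χ χ₁ χ₂) {c : ℝ} (hc : 0 < c)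
    {u g : (Fin d → ℝ) → ℝ} {u₁ u₂ : Fin d → (Fin d → ℝ) → ℝ} (hu : Continuous u)
    (hg : Continuous g) (hu₁ : ∀ j, Continuous (u₁ j)) (hu₂ : ∀ j, Continuous (u₂ j))
    (hd₁ : ∀ j w, HasLineDerivAt ℝ u (u₁ j w) w (Pi.single j 1))
    (hd₂ : ∀ j w, HasLineDerivAt ℝ (u₁ j) (u₂ j w) w (Pi.single j 1)) :
    ∫ z, ((1 / (2 * c)) * ∑ j, z j * χ₁ j (c • z)) * u (c • z) +
        χ (c • z) * (-g (c • z) - (1 / 2) * ∑ j, u₂ j (c • z)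
          + (1 / (2 * c)) * ∑ j, z j * u₁ j (c • z)) ∂stdGaussianPi d
      = ∫ z, (-(χ (c • z) * g (c • z)) + (1 / c) * ∑ j, z j * (u (c • z) * χ₁ j (c • z))
          - (1 / 2) * ∑ j, u (c • z) * χ₂ j (c • z)) ∂stdGaussianPi d := by
  have hsm : Continuous fun z : Fin d → ℝ => c • z := by fun_prop
  obtain ⟨r, -, hr⟩ := h.exists_radius
  have hrz : ∀ z : Fin d → ℝ, z ∉ Metric.closedBall 0 (r / c) → r ≤ ‖c • z‖ := by
    intro z hz
    rw [mem_closedBall_zero_iff, not_le, div_lt_iff₀ hc] at hz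
    rw [norm_smul, Real.norm_eq_abs, abs_of_pos hc, mul_comm]
    exact hz.le
  have cont : Continuous fun z : Fin d → ℝ => χ (c • z) := h.cont.comp hsm
  have cont₁ : ∀ j, Continuous fun z : Fin d → ℝ => χ₁ j (c • z) := fun j => (h.cont₁ j).comp hsm
  have cont₂ : ∀ j, Continuous fun z : Fin d → ℝ => χ₂ j (c • z) := fun j => (h.cont₂ j).comp hsm
  have supp := HasCompactSupport.comp_const_smul h.supp hc.ne'
  have supp₁ := fun j => HasCompactSupport.comp_const_smul (h.supp₁ j) hc.ne'
  have supp₂ := fun j => HasCompactSupport.comp_const_smul (h.supp₂ j) hc.ne'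
  have contu : Continuous fun z : Fin d → ℝ => u (c • z) := hu.comp hsm
  have contg : Continuous fun z : Fin d → ℝ => g (c • z) := hg.comp hsm
  have contu₁ : ∀ j, Continuous fun z : Fin d → ℝ => u₁ j (c • z) := fun j => (hu₁ j).comp hsm
  have contu₂ : ∀ j, Continuous fun z : Fin d → ℝ => u₂ j (c • z) := fun j => (hu₂ j).comp hsm
  have int : ∀ {f : (Fin d → ℝ) → ℝ}, Continuous f → HasCompactSupport f →
      Integrable f (stdGaussianPi d) := fun hf hs => hf.integrable_of_hasCompactSupport hs
  -- Two integrations by parts are used: for `f = χ ∂ⱼu`, which removes `∂ⱼ²u`, and for `k = u ∂ⱼχ`,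
  -- which removes the cross term `∂ⱼχ ∂ⱼu` left by the first. The chain-rule factor `c` in `f'` and
  -- `k'` cancels against `1 / (2c)`.
  let f : Fin d → (Fin d → ℝ) → ℝ := fun j z => χ (c • z) * u₁ j (c • z)
  let f' : Fin d → (Fin d → ℝ) → ℝ := fun j z =>
    c * χ₁ j (c • z) * u₁ j (c • z) + χ (c • z) * (c * u₂ j (c • z))
  let k : Fin d → (Fin d → ℝ) → ℝ := fun j z => χ₁ j (c • z) * u (c • z)
  let k' : Fin d → (Fin d → ℝ) → ℝ := fun j z =>
    c * χ₂ j (c • z) * u (c • z) + χ₁ j (c • z) * (c * u₁ j (c • z))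
  have hf : ∀ j, Continuous (f j) := fun j => cont.mul (contu₁ j)
  have hf' : ∀ j, Continuous (f' j) := fun j =>
    ((continuous_const.mul (cont₁ j)).mul (contu₁ j)).add
      (cont.mul (continuous_const.mul (contu₂ j)))
  have hk : ∀ j, Continuous (k j) := fun j => (cont₁ j).mul contu
  have hk' : ∀ j, Continuous (k' j) := fun j =>
    ((continuous_const.mul (cont₂ j)).mul contu).add
      ((cont₁ j).mul (continuous_const.mul (contu₁ j)))
  have sf : ∀ j, HasCompactSupport (f j) := fun j => supp.mul_right
  have sf' : ∀ j, HasCompactSupport (f' j) := fun j =>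
    ((supp₁ j).mul_left.mul_right).add supp.mul_right
  have sk : ∀ j, HasCompactSupport (k j) := fun j => (supp₁ j).mul_right
  have sk' : ∀ j, HasCompactSupport (k' j) := fun j =>
    ((supp₂ j).mul_left.mul_right).add (supp₁ j).mul_right
  have Sf := fun j => integral_lineDeriv_stdGaussianPi j (hf j) (hf' j) (sf j) (sf' j) fun z =>
    hasLineDerivAt_mul (hasLineDerivAt_comp_smul (h.deriv₁ j _)) (hasLineDerivAt_comp_smul (hd₂ j _))
  have Sk := fun j => integral_lineDeriv_stdGaussianPi j (hk j) (hk' j) (sk j) (sk' j) fun z =>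
    hasLineDerivAt_mul (hasLineDerivAt_comp_smul (h.deriv₂ j _)) (hasLineDerivAt_comp_smul (hd₁ j _))
  have cz : ∀ j : Fin d, Continuous fun z : Fin d → ℝ => z j := fun j => continuous_apply j
  have If' := fun j => int (hf' j) (sf' j)
  have Ik' := fun j => int (hk' j) (sk' j)
  have If : ∀ j, Integrable (fun z : Fin d → ℝ => z j * f j z) (stdGaussianPi d) := fun j =>
    int ((cz j).mul (hf j)) (sf j).mul_left
  have Ik : ∀ j, Integrable (fun z : Fin d → ℝ => z j * k j z) (stdGaussianPi d) := fun j =>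
    int ((cz j).mul (hk j)) (sk j).mul_left
  rw [← sub_eq_zero, ← integral_sub]
  · have hpt : ∀ z : Fin d → ℝ,
        (((1 / (2 * c)) * ∑ j, z j * χ₁ j (c • z)) * u (c • z) +
        χ (c • z) * (-g (c • z) - (1 / 2) * ∑ j, u₂ j (c • z)
          + (1 / (2 * c)) * ∑ j, z j * u₁ j (c • z))) -
        (-(χ (c • z) * g (c • z)) + (1 / c) * ∑ j, z j * (u (c • z) * χ₁ j (c • z))
          - (1 / 2) * ∑ j, u (c • z) * χ₂ j (c • z))
        = ∑ j, (1 / (2 * c)) * ((z j * f j z - f' j z) - (z j * k j z - k' j z)) := by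
      intro z
      have e : ∀ A P X Y Q R : ℝ, ((1 / (2 * c)) * A) * u (c • z) +
          χ (c • z) * (-g (c • z) - (1 / 2) * P + (1 / (2 * c)) * X) -
          (-(χ (c • z) * g (c • z)) + (1 / c) * Q - (1 / 2) * R) =
          (1 / (2 * c)) * (A * u (c • z)) - (1 / 2) * (χ (c • z) * P)
            + (1 / (2 * c)) * (χ (c • z) * X) - (1 / c) * Q + (1 / 2) * R := by
        intros; ring
      rw [e _ _ _ 0]
      simp only [Finset.mul_sum, Finset.sum_mul, ← Finset.sum_sub_distrib,
        ← Finset.sum_add_distrib]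
      refine Finset.sum_congr rfl fun j _ => ?_
      simp only [f, f', k, k']
      field_simp
      ring
    simp_rw [hpt]
    rw [integral_finsetSum]
    · refine Finset.sum_eq_zero fun j _ => ?_
      have I1 : Integrable (fun z : Fin d → ℝ => z j * f j z - f' j z) (stdGaussianPi d) :=
        (If j).sub (If' j)
      have I2 : Integrable (fun z : Fin d → ℝ => z j * k j z - k' j z) (stdGaussianPi d) :=
        (Ik j).sub (Ik' j)
      rw [integral_const_mul, integral_sub I1 I2, integral_sub (If j) (If' j),
        integral_sub (Ik j) (Ik' j), Sf j, Sk j]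
      simp
    · exact fun j _ => (((If j).sub (If' j)).sub ((Ik j).sub (Ik' j))).const_mul _
  · refine int ?_ (.intro (isCompact_closedBall 0 (r / c)) fun z hz => ?_)
    · exact ((continuous_const.mul (continuous_finsetSum _ fun j _ => (cz j).mul (cont₁ j))).mul
        contu).add (cont.mul ((contg.neg.sub (continuous_const.mul (continuous_finsetSum _
          fun j _ => contu₂ j))).add (continuous_const.mul (continuous_finsetSum _ fun j _ =>
            (cz j).mul (contu₁ j)))))
    · obtain ⟨h0, h1, -⟩ := hr (c • z) (hrz z hz)
      simp [h0, h1]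
  · refine int ?_ (.intro (isCompact_closedBall 0 (r / c)) fun z hz => ?_)
    · exact ((cont.mul contg).neg.add (continuous_const.mul (continuous_finsetSum _ fun j _ =>
        (cz j).mul (contu.mul (cont₁ j))))).sub (continuous_const.mul (continuous_finsetSum _
          fun j _ => contu.mul (cont₂ j)))
    · obtain ⟨h0, h1, h2⟩ := hr (c • z) (hrz z hz)
      simp [h0, h1, h2]

/-! ### Heat equation with source -/

/-- Data for the backward heat equation `∂U/∂v + ½ ΔU = -G` on `(0, S) × ℝ^d`, with the time
derivative taken along the curves `v ↦ √v z`. -/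
structure IsHeatData {d : ℕ} (S κ C : ℝ) (U G : ℝ → (Fin d → ℝ) → ℝ)
    (U₁ U₂ : Fin d → ℝ → (Fin d → ℝ) → ℝ) : Prop where
  cont : ContinuousOn (fun p : ℝ × (Fin d → ℝ) => U p.1 p.2) (Icc 0 S ×ˢ univ)
  contG : ContinuousOn (fun p : ℝ × (Fin d → ℝ) => G p.1 p.2) (Icc 0 S ×ˢ univ)
  cont₁ : ∀ j, ContinuousOn (fun p : ℝ × (Fin d → ℝ) => U₁ j p.1 p.2) (Ioo 0 S ×ˢ univ)
  cont₂ : ∀ j, ContinuousOn (fun p : ℝ × (Fin d → ℝ) => U₂ j p.1 p.2) (Ioo 0 S ×ˢ univ)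
  bound : ∀ v ∈ Icc 0 S, ∀ w, |U v w| ≤ C * Real.exp (κ * ∑ l, |w l|)
  boundG : ∀ v ∈ Icc 0 S, ∀ w, |G v w| ≤ C * Real.exp (κ * ∑ l, |w l|)
  nonneg_κ : 0 ≤ κ
  nonneg_C : 0 ≤ C
  deriv_t : ∀ v ∈ Ioo 0 S, ∀ z : Fin d → ℝ, HasDerivAt (fun u => U u (√u • z))
    (-G v (√v • z) - (1 / 2) * ∑ j, U₂ j v (√v • z)
      + (1 / (2 * √v)) * ∑ j, z j * U₁ j v (√v • z)) v
  deriv₁ : ∀ v ∈ Ioo 0 S, ∀ j w, HasLineDerivAt ℝ (U v) (U₁ j v w) w (Pi.single j 1)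
  deriv₂ : ∀ v ∈ Ioo 0 S, ∀ j w, HasLineDerivAt ℝ (U₁ j v) (U₂ j v w) w (Pi.single j 1)

section

variable {d : ℕ}

theorem continuousOn_comp_sqrt_smul {F : ℝ → (Fin d → ℝ) → ℝ} {I I' : Set ℝ}
    (hF : ContinuousOn (fun p : ℝ × (Fin d → ℝ) => F p.1 p.2) (I ×ˢ univ)) (hI : I' ⊆ I) :
    ContinuousOn (fun p : ℝ × (Fin d → ℝ) => F p.1 (√p.1 • p.2)) (I' ×ˢ univ) :=
  hF.comp (f := fun p : ℝ × (Fin d → ℝ) => (p.1, √p.1 • p.2)) (by fun_prop)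
    fun _ hp => ⟨hI hp.1, mem_univ _⟩

theorem continuous_slice {F : ℝ → (Fin d → ℝ) → ℝ} {I : Set ℝ}
    (hF : ContinuousOn (fun p : ℝ × (Fin d → ℝ) => F p.1 p.2) (I ×ˢ univ)) {v : ℝ} (hv : v ∈ I) :
    Continuous (F v) := by
  rw [← continuousOn_univ]
  exact hF.comp (f := fun w : Fin d → ℝ => (v, w)) (by fun_prop) fun _ _ => ⟨hv, mem_univ _⟩

/-- Since `√v ≤ √S`, one exponential in `z` dominates at all times `v`. -/
theorem abs_comp_sqrt_smul_le {F : ℝ → (Fin d → ℝ) → ℝ} {S κ C : ℝ} (hκ : 0 ≤ κ) (hC : 0 ≤ C)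
    (hb : ∀ v ∈ Icc 0 S, ∀ w, |F v w| ≤ C * Real.exp (κ * ∑ l, |w l|)) {v : ℝ} (hv : v ∈ Icc 0 S)
    (z : Fin d → ℝ) : |F v (√v • z)| ≤ C * Real.exp (κ * √S * ∑ l, |z l|) := by
  refine (hb v hv _).trans (mul_le_mul_of_nonneg_left (Real.exp_le_exp.2 ?_) hC)
  rw [mul_assoc]
  refine mul_le_mul_of_nonneg_left ?_ hκ
  rw [Finset.mul_sum]
  refine Finset.sum_le_sum fun l _ => ?_
  rw [Pi.smul_apply, smul_eq_mul, abs_mul, abs_of_nonneg (Real.sqrt_nonneg v)]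
  exact mul_le_mul_of_nonneg_right (Real.sqrt_le_sqrt hv.2) (abs_nonneg _)

theorem integrable_comp_sqrt_smul {F : ℝ → (Fin d → ℝ) → ℝ} {S κ C : ℝ} (hκ : 0 ≤ κ) (hC : 0 ≤ C)
    (hF : ContinuousOn (fun p : ℝ × (Fin d → ℝ) => F p.1 p.2) (Icc 0 S ×ˢ univ))
    (hb : ∀ v ∈ Icc 0 S, ∀ w, |F v w| ≤ C * Real.exp (κ * ∑ l, |w l|)) {v : ℝ}
    (hv : v ∈ Icc 0 S) : Integrable (fun z => F v (√v • z)) (stdGaussianPi d) :=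
  ((integrable_exp_sum_abs d (κ * √S)).const_mul C).mono'
    ((continuous_slice hF hv).comp (by fun_prop)).aestronglyMeasurable
    (ae_of_all _ fun z => abs_comp_sqrt_smul_le hκ hC hb hv z)

theorem continuousOn_integral_comp_sqrt_smul {F : ℝ → (Fin d → ℝ) → ℝ} {S κ C : ℝ} (hκ : 0 ≤ κ)
    (hC : 0 ≤ C) (hF : ContinuousOn (fun p : ℝ × (Fin d → ℝ) => F p.1 p.2) (Icc 0 S ×ˢ univ))
    (hb : ∀ v ∈ Icc 0 S, ∀ w, |F v w| ≤ C * Real.exp (κ * ∑ l, |w l|)) :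
    ContinuousOn (fun v => ∫ z, F v (√v • z) ∂stdGaussianPi d) (Icc 0 S) := by
  refine continuousOn_of_dominated (bound := fun z => C * Real.exp (κ * √S * ∑ l, |z l|))
    (fun v hv => (integrable_comp_sqrt_smul hκ hC hF hb hv).aestronglyMeasurable)
    (fun v hv => ae_of_all _ fun z => abs_comp_sqrt_smul_le hκ hC hb hv z)
    ((integrable_exp_sum_abs d (κ * √S)).const_mul C) (ae_of_all _ fun z => ?_)
  exact (continuousOn_comp_sqrt_smul hF subset_rfl).comp (f := fun v : ℝ => (v, z)) (by fun_prop)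
    fun v hv => ⟨hv, mem_univ _⟩

theorem aestronglyMeasurable_Ioc_prod {f : ℝ × (Fin d → ℝ) → ℝ} {v₁ v₂ : ℝ}
    (hf : ContinuousOn f (Icc v₁ v₂ ×ˢ univ)) :
    AEStronglyMeasurable f ((volume.restrict (Ioc v₁ v₂)).prod (stdGaussianPi d)) := by
  have h : (volume.restrict (Ioc v₁ v₂)).prod (stdGaussianPi d)
      = ((volume : Measure ℝ).prod (stdGaussianPi d)).restrict (Ioc v₁ v₂ ×ˢ univ) := by
    rw [← Measure.prod_restrict, Measure.restrict_univ]
  rw [h]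
  exact (hf.mono (prod_mono Ioc_subset_Icc_self subset_rfl)).aestronglyMeasurable
    (measurableSet_Ioc.prod MeasurableSet.univ)

theorem ae_mem_Ioc_prod (v₁ v₂ : ℝ) :
    ∀ᵐ p ∂(volume.restrict (Ioc v₁ v₂)).prod (stdGaussianPi d), p.1 ∈ Ioc v₁ v₂ :=
  Measure.quasiMeasurePreserving_fst.ae (ae_restrict_mem measurableSet_Ioc)

theorem integrable_prod_of_bound {f : ℝ × (Fin d → ℝ) → ℝ} {v₁ v₂ A κ : ℝ}
    (hf : ContinuousOn f (Icc v₁ v₂ ×ˢ univ))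
    (hb : ∀ v ∈ Ioc v₁ v₂, ∀ z, |f (v, z)| ≤ A * Real.exp (κ * ∑ l, |z l|)) :
    Integrable f ((volume.restrict (Ioc v₁ v₂)).prod (stdGaussianPi d)) := by
  refine Integrable.mono' (((integrable_exp_sum_abs d κ).const_mul A).comp_snd _)
    (aestronglyMeasurable_Ioc_prod hf) ?_
  filter_upwards [ae_mem_Ioc_prod v₁ v₂] with p hp
  exact hb p.1 hp p.2

end

/-- The integrand left after integrating by parts in the localised heat equation. -/
def cutoffRemainder {d : ℕ} (U G : ℝ → (Fin d → ℝ) → ℝ) (χ : (Fin d → ℝ) → ℝ)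
    (χ₁ χ₂ : Fin d → (Fin d → ℝ) → ℝ) (p : ℝ × (Fin d → ℝ)) : ℝ :=
  -(χ (√p.1 • p.2) * G p.1 (√p.1 • p.2))
    + (1 / √p.1) * ∑ j, p.2 j * (U p.1 (√p.1 • p.2) * χ₁ j (√p.1 • p.2))
    - (1 / 2) * ∑ j, U p.1 (√p.1 • p.2) * χ₂ j (√p.1 • p.2)

namespace IsHeatData

variable {d : ℕ} {S κ C : ℝ} {U G : ℝ → (Fin d → ℝ) → ℝ} {U₁ U₂ : Fin d → ℝ → (Fin d → ℝ) → ℝ}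
  (H : IsHeatData S κ C U G U₁ U₂)

include H

theorem continuousOn_cutoffRemainder {B : ℝ} {χ : (Fin d → ℝ) → ℝ}
    {χ₁ χ₂ : Fin d → (Fin d → ℝ) → ℝ} (h : IsCutoff B χ χ₁ χ₂) {v₁ v₂ : ℝ} (hv₁ : 0 < v₁)
    (hv₂ : v₂ < S) : ContinuousOn (cutoffRemainder U G χ χ₁ χ₂) (Icc v₁ v₂ ×ˢ univ) := by
  have hI : Icc v₁ v₂ ⊆ Icc 0 S := fun v hv => ⟨hv₁.le.trans hv.1, hv.2.trans hv₂.le⟩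
  have cU := continuousOn_comp_sqrt_smul H.cont hI
  have cG := continuousOn_comp_sqrt_smul H.contG hI
  have sm : Continuous fun p : ℝ × (Fin d → ℝ) => √p.1 • p.2 := by fun_prop
  have c0 := (h.cont.comp sm).continuousOn (s := Icc v₁ v₂ ×ˢ univ)
  have c1 := fun j => ((h.cont₁ j).comp sm).continuousOn (s := Icc v₁ v₂ ×ˢ univ)
  have c2 := fun j => ((h.cont₂ j).comp sm).continuousOn (s := Icc v₁ v₂ ×ˢ univ)
  have cz : ∀ j : Fin d, ContinuousOn (fun p : ℝ × (Fin d → ℝ) => p.2 j) (Icc v₁ v₂ ×ˢ univ) :=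
    fun j => by fun_prop
  have ci : ContinuousOn (fun p : ℝ × (Fin d → ℝ) => 1 / √p.1) (Icc v₁ v₂ ×ˢ univ) :=
    continuousOn_const.div (by fun_prop) fun p hp =>
      (Real.sqrt_pos.2 (hv₁.trans_le hp.1.1)).ne'
  exact ((c0.mul cG).neg.add (ci.mul (continuousOn_finsetSum _ fun j _ =>
    (cz j).mul (cU.mul (c1 j))))).sub (continuousOn_const.mul (continuousOn_finsetSum _ fun j _ =>
      cU.mul (c2 j)))

/-- The bound sees the cutoff only through `B` and contains no derivative of `U`. Staying above `v₁
> 0` controls `1 / √v`; the linear factor in `z` is absorbed by `s ≤ exp s`, whence the exponent `κ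
* √S + 1`. -/
theorem abs_cutoffRemainder_le {B : ℝ} {χ : (Fin d → ℝ) → ℝ}
    {χ₁ χ₂ : Fin d → (Fin d → ℝ) → ℝ} (h : IsCutoff B χ χ₁ χ₂) {v₁ v₂ : ℝ} (hv₁ : 0 < v₁)
    (hv₂ : v₂ < S) {v : ℝ} (hv : v ∈ Ioc v₁ v₂) (z : Fin d → ℝ) :
    |cutoffRemainder U G χ χ₁ χ₂ (v, z)| ≤
      C * (1 + 1 / √v₁ * B + d * B) * Real.exp ((κ * √S + 1) * ∑ l, |z l|) := by
  have hvS : v ∈ Icc 0 S := ⟨hv₁.le.trans hv.1.le, hv.2.trans hv₂.le⟩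
  have bU := abs_comp_sqrt_smul_le H.nonneg_κ H.nonneg_C H.bound hvS z
  have bG := abs_comp_sqrt_smul_le H.nonneg_κ H.nonneg_C H.boundG hvS z
  have hC := H.nonneg_C
  have hB := h.nonneg_B
  set s := ∑ l, |z l| with hs
  have hs0 : 0 ≤ s := Finset.sum_nonneg fun _ _ => abs_nonneg _
  set e := Real.exp (κ * √S * s) with he
  have he0 : 0 < e := Real.exp_pos _
  have hexp : Real.exp ((κ * √S + 1) * s) = e * Real.exp s := by
    rw [he, ← Real.exp_add]; ring_nf
  have hse : s ≤ Real.exp s := (by linarith [Real.add_one_le_exp s])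
  have h1e : 1 ≤ Real.exp s := Real.one_le_exp hs0
  have t1 : |χ (√v • z) * G v (√v • z)| ≤ C * e := by
    rw [abs_mul]
    exact (mul_le_of_le_one_left (abs_nonneg _) (h.bound _)).trans bG
  have t2 : |(1 / √v) * ∑ j, z j * (U v (√v • z) * χ₁ j (√v • z))| ≤
      1 / √v₁ * (s * (C * e * B)) := by
    rw [abs_mul, abs_of_nonneg (by positivity)]
    refine mul_le_mul (one_div_le_one_div_of_le (Real.sqrt_pos.2 hv₁)
      (Real.sqrt_le_sqrt hv.1.le)) ?_ (abs_nonneg _) (by positivity)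
    refine (Finset.abs_sum_le_sum_abs _ _).trans ?_
    rw [hs, Finset.sum_mul]
    refine Finset.sum_le_sum fun j _ => ?_
    rw [abs_mul, abs_mul]
    exact mul_le_mul_of_nonneg_left (mul_le_mul bU (h.bound₁ j _) (abs_nonneg _) (by positivity))
      (abs_nonneg _)
  have t3 : |(1 / 2) * ∑ j, U v (√v • z) * χ₂ j (√v • z)| ≤ d * (C * e * B) := by
    rw [abs_mul, abs_of_nonneg (by norm_num)]
    refine (mul_le_of_le_one_left (abs_nonneg _) (by norm_num)).trans ?_
    refine (Finset.abs_sum_le_sum_abs _ _).trans ?_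
    refine (Finset.sum_le_card_nsmul _ _ (C * e * B) fun j _ => ?_).trans (by simp)
    rw [abs_mul]
    exact mul_le_mul bU (h.bound₂ j _) (abs_nonneg _) (by positivity)
  have q1 : C * e ≤ C * e * Real.exp s := le_mul_of_one_le_right (by positivity) h1e
  have q2 : 1 / √v₁ * (s * (C * e * B)) ≤ 1 / √v₁ * (Real.exp s * (C * e * B)) := by gcongr
  have q3 : d * (C * e * B) ≤ d * (C * e * B) * Real.exp s :=
    le_mul_of_one_le_right (by positivity) h1e
  calc |cutoffRemainder U G χ χ₁ χ₂ (v, z)|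
      ≤ |-(χ (√v • z) * G v (√v • z))
        + (1 / √v) * ∑ j, z j * (U v (√v • z) * χ₁ j (√v • z))|
        + |(1 / 2) * ∑ j, U v (√v • z) * χ₂ j (√v • z)| := abs_sub _ _
    _ ≤ |χ (√v • z) * G v (√v • z)| + |(1 / √v) * ∑ j, z j * (U v (√v • z) * χ₁ j (√v • z))|
        + |(1 / 2) * ∑ j, U v (√v • z) * χ₂ j (√v • z)| := by
          gcongr
          exact (abs_add_le _ _).trans (by rw [abs_neg])
    _ ≤ C * (1 + 1 / √v₁ * B + d * B) * Real.exp ((κ * √S + 1) * s) := by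
          rw [hexp]
          linarith

/-- For each fixed `z` the fundamental theorem of calculus applies along `v ↦ √v z`; Fubini then
exchanges the integrals, and at each fixed `v` integration by parts replaces the derivative by the
remainder. -/
theorem integral_cutoff_sub {B : ℝ} {χ : (Fin d → ℝ) → ℝ}
    {χ₁ χ₂ : Fin d → (Fin d → ℝ) → ℝ} (h : IsCutoff B χ χ₁ χ₂) {v₁ v₂ : ℝ} (hv₁ : 0 < v₁)
    (hv : v₁ ≤ v₂) (hv₂ : v₂ < S) :
    (∫ z, χ (√v₂ • z) * U v₂ (√v₂ • z) ∂stdGaussianPi d)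
      - ∫ z, χ (√v₁ • z) * U v₁ (√v₁ • z) ∂stdGaussianPi d
      = ∫ p, cutoffRemainder U G χ χ₁ χ₂ p
        ∂(volume.restrict (Ioc v₁ v₂)).prod (stdGaussianPi d) := by
  have hI : Icc v₁ v₂ ⊆ Icc 0 S := fun v hv => ⟨hv₁.le.trans hv.1, hv.2.trans hv₂.le⟩
  have hI' : Icc v₁ v₂ ⊆ Ioo 0 S := fun v hv => ⟨hv₁.trans_le hv.1, hv.2.trans_lt hv₂⟩
  -- `D (v, z)` is the derivative of `χ(√v z) U(v, √v z)` in `v`.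
  let D : ℝ × (Fin d → ℝ) → ℝ := fun p =>
    ((1 / (2 * √p.1)) * ∑ j, p.2 j * χ₁ j (√p.1 • p.2)) * U p.1 (√p.1 • p.2) +
        χ (√p.1 • p.2) * (-G p.1 (√p.1 • p.2) - (1 / 2) * ∑ j, U₂ j p.1 (√p.1 • p.2)
          + (1 / (2 * √p.1)) * ∑ j, p.2 j * U₁ j p.1 (√p.1 • p.2))
  have hDc : ContinuousOn D (Icc v₁ v₂ ×ˢ univ) := by
    have cU := continuousOn_comp_sqrt_smul H.cont hI
    have cG := continuousOn_comp_sqrt_smul H.contG hI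
    have cU₁ := fun j => continuousOn_comp_sqrt_smul (H.cont₁ j) hI'
    have cU₂ := fun j => continuousOn_comp_sqrt_smul (H.cont₂ j) hI'
    have sm : Continuous fun p : ℝ × (Fin d → ℝ) => √p.1 • p.2 := by fun_prop
    have c0 := (h.cont.comp sm).continuousOn (s := Icc v₁ v₂ ×ˢ univ)
    have c1 := fun j => ((h.cont₁ j).comp sm).continuousOn (s := Icc v₁ v₂ ×ˢ univ)
    have cz : ∀ j : Fin d, ContinuousOn (fun p : ℝ × (Fin d → ℝ) => p.2 j)
      (Icc v₁ v₂ ×ˢ univ) := fun j => by fun_prop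
    have ci : ContinuousOn (fun p : ℝ × (Fin d → ℝ) => 1 / (2 * √p.1)) (Icc v₁ v₂ ×ˢ univ) :=
      continuousOn_const.div (by fun_prop) fun p hp =>
        (mul_pos two_pos (Real.sqrt_pos.2 (hv₁.trans_le hp.1.1))).ne'
    exact ((ci.mul (continuousOn_finsetSum _ fun j _ => (cz j).mul (c1 j))).mul cU).add
      (c0.mul ((cG.neg.sub (continuousOn_const.mul (continuousOn_finsetSum _ fun j _ =>
        cU₂ j))).add (ci.mul (continuousOn_finsetSum _ fun j _ => (cz j).mul (cU₁ j)))))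
  -- As `v ≥ v₁ > 0`, the cutoff and its gradient vanish for `‖z‖ > r / √v₁`; on the remaining
  -- compact set continuity bounds `D`, so no growth bound on the derivatives of `U` is needed.
  obtain ⟨A, hA⟩ : ∃ A, ∀ v ∈ Icc v₁ v₂, ∀ z, |D (v, z)| ≤ A := by
    obtain ⟨r, hr, hχ⟩ := h.exists_radius
    have hcomp : IsCompact (Icc v₁ v₂ ×ˢ Metric.closedBall (0 : Fin d → ℝ) (r / √v₁)) :=
      isCompact_Icc.prod (isCompact_closedBall _ _)
    obtain ⟨A, hA⟩ := hcomp.exists_bound_of_continuousOn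
      (hDc.mono (prod_mono subset_rfl (subset_univ _)))
    refine ⟨max A 0, fun v hv z => ?_⟩
    by_cases hz : z ∈ Metric.closedBall (0 : Fin d → ℝ) (r / √v₁)
    · exact (hA (v, z) ⟨hv, hz⟩).trans (le_max_left _ _)
    · rw [mem_closedBall_zero_iff, not_le, div_lt_iff₀ (Real.sqrt_pos.2 hv₁)] at hz
      obtain ⟨h0, h1, -⟩ := hχ (√v • z) (by
        rw [norm_smul, Real.norm_eq_abs, abs_of_nonneg (Real.sqrt_nonneg v), mul_comm]
        exact hz.le.trans (mul_le_mul_of_nonneg_left (Real.sqrt_le_sqrt hv.1) (norm_nonneg _)))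
      simp [D, h0, h1]
  have hDi : Integrable D ((volume.restrict (Ioc v₁ v₂)).prod (stdGaussianPi d)) :=
    integrable_prod_of_bound (A := A) (κ := 0) hDc fun v hv z => by
      simpa using hA v (Ioc_subset_Icc_self hv) z
  have hQi : Integrable (cutoffRemainder U G χ χ₁ χ₂)
      ((volume.restrict (Ioc v₁ v₂)).prod (stdGaussianPi d)) :=
    integrable_prod_of_bound (H.continuousOn_cutoffRemainder h hv₁ hv₂)
      fun v hv z => H.abs_cutoffRemainder_le h hv₁ hv₂ hv z
  have hχU : ∀ v ∈ Icc v₁ v₂,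
      Integrable (fun z => χ (√v • z) * U v (√v • z)) (stdGaussianPi d) := by
    intro v hv
    refine (integrable_comp_sqrt_smul H.nonneg_κ H.nonneg_C H.cont H.bound (hI hv)).bdd_mul
      (c := 1) (h.cont.comp (by fun_prop)).aestronglyMeasurable (ae_of_all _ fun z => h.bound _)
  have hftc : ∀ z : Fin d → ℝ, χ (√v₂ • z) * U v₂ (√v₂ • z) - χ (√v₁ • z) * U v₁ (√v₁ • z)
      = ∫ v in Ioc v₁ v₂, D (v, z) := by
    intro z
    rw [← intervalIntegral.integral_of_le hv]
    refine (intervalIntegral.integral_eq_sub_of_hasDerivAt (f := fun v =>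
      χ (√v • z) * U v (√v • z)) (fun v hv' => ?_) (ContinuousOn.intervalIntegrable ?_)).symm
    · rw [uIcc_of_le hv] at hv'
      have hv0 : 0 < v := hv₁.trans_le hv'.1
      refine HasDerivAt.fun_mul ?_ (H.deriv_t v (hI' hv') z)
      have hdiff : HasFDerivAt χ (∑ j, χ₁ j (√v • z) •
          ContinuousLinearMap.proj (R := ℝ) (φ := fun _ : Fin d => ℝ) j) (√v • z) :=
        hasFDerivAt_of_continuousAt_lineDeriv (fun j => Pi.single j 1) _
          (fun x => by ext l; simp [Finset.sum_apply, Pi.single_apply])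
          (fun j => Eventually.of_forall fun y => h.deriv₁ j y) fun j => (h.cont₁ j).continuousAt
      have hs : HasDerivAt (fun v : ℝ => √v • z) ((1 / (2 * √v)) • z) v :=
        (Real.hasDerivAt_sqrt hv0.ne').smul_const z
      refine (hdiff.comp_hasDerivAt v hs).congr_deriv ?_
      simp only [_root_.sum_apply, _root_.smul_apply,
        ContinuousLinearMap.proj_apply, Pi.smul_apply, smul_eq_mul, Finset.mul_sum]
      exact Finset.sum_congr rfl fun j _ => by ring
    · rw [uIcc_of_le hv]
      exact hDc.comp (f := fun v : ℝ => (v, z)) (by fun_prop) fun v hv' => ⟨hv', mem_univ _⟩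
  rw [← integral_sub (hχU v₂ (right_mem_Icc.2 hv)) (hχU v₁ (left_mem_Icc.2 hv))]
  simp_rw [hftc]
  rw [← integral_prod_symm D hDi, integral_prod D hDi, integral_prod _ hQi]
  refine setIntegral_congr_fun measurableSet_Ioc fun v hv' => ?_
  have hv'' := Ioc_subset_Icc_self hv'
  exact integral_cutoff_generator h (Real.sqrt_pos.2 (hv₁.trans hv'.1))
    (continuous_slice H.cont (hI hv'')) (continuous_slice H.contG (hI hv''))
    (fun j => continuous_slice (H.cont₁ j) (hI' hv''))
    (fun j => continuous_slice (H.cont₂ j) (hI' hv''))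
    (H.deriv₁ v (hI' hv'')) (H.deriv₂ v (hI' hv''))

/-- The dilated cutoffs `χ(w / (n + 1))` tend to `1` and their derivatives to `0`, so only `-G`
survives in the remainder. -/
theorem integral_sub_integral {v₁ v₂ : ℝ} (hv₁ : 0 < v₁) (hv : v₁ ≤ v₂) (hv₂ : v₂ < S) :
    (∫ z, U v₂ (√v₂ • z) ∂stdGaussianPi d) - ∫ z, U v₁ (√v₁ • z) ∂stdGaussianPi d
      = -∫ v in v₁..v₂, ∫ z, G v (√v • z) ∂stdGaussianPi d := by
  have hI : Icc v₁ v₂ ⊆ Icc 0 S := fun v hv => ⟨hv₁.le.trans hv.1, hv.2.trans hv₂.le⟩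
  obtain ⟨B, χ, χ₁, χ₂, h, hχ1⟩ := exists_isCutoff d
  let c : ℕ → ℝ := fun n => 1 / ((n : ℝ) + 1)
  have hc0 : ∀ n, 0 < c n := fun n => by positivity
  have hc1 : ∀ n, c n ≤ 1 := fun n => by
    rw [div_le_one (by positivity)]
    linarith [Nat.cast_nonneg (α := ℝ) n]
  have hc : Tendsto c atTop (𝓝 0) := tendsto_one_div_add_atTop_nhds_zero_nat
  have hcut := fun n => h.comp_smul (hc0 n) (hc1 n)
  have hcw : ∀ w : Fin d → ℝ, Tendsto (fun n => c n • w) atTop (𝓝 0) := fun w => by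
    simpa using hc.smul_const w
  have hone : ∀ w : Fin d → ℝ, Tendsto (fun n => χ (c n • w)) atTop (𝓝 1) := fun w =>
    tendsto_const_nhds.congr' (by
      filter_upwards [(hcw w).eventually hχ1] with n hn using hn.symm)
  have hone₁ : ∀ j (w : Fin d → ℝ), Tendsto (fun n => c n * χ₁ j (c n • w)) atTop (𝓝 0) :=
    fun j w => by
      simpa using hc.mul (((h.cont₁ j).tendsto 0).comp (hcw w))
  have hone₂ : ∀ j (w : Fin d → ℝ),
      Tendsto (fun n => c n * (c n * χ₂ j (c n • w))) atTop (𝓝 0) :=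
    fun j w => by
      simpa using hc.mul (hc.mul (((h.cont₂ j).tendsto 0).comp (hcw w)))
  have hlim : ∀ v ∈ Icc v₁ v₂, Tendsto
      (fun n => ∫ z, χ (c n • √v • z) * U v (√v • z) ∂stdGaussianPi d) atTop
      (𝓝 (∫ z, U v (√v • z) ∂stdGaussianPi d)) := by
    intro v hv
    have hint := integrable_comp_sqrt_smul H.nonneg_κ H.nonneg_C H.cont H.bound (hI hv)
    refine tendsto_integral_of_dominated_convergence (fun z => |U v (√v • z)|) (fun n => ?_)
      hint.abs (fun n => ae_of_all _ fun z => ?_) (ae_of_all _ fun z => ?_)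
    · exact ((h.cont.comp (by fun_prop)).aestronglyMeasurable).mul hint.aestronglyMeasurable
    · rw [norm_mul]
      exact mul_le_of_le_one_left (norm_nonneg _) (h.bound _)
    · simpa using (hone (√v • z)).mul_const (U v (√v • z))
  have hR : Tendsto (fun n => ∫ p, cutoffRemainder U G (fun w => χ (c n • w))
        (fun j w => c n * χ₁ j (c n • w)) (fun j w => c n * (c n * χ₂ j (c n • w))) p
        ∂(volume.restrict (Ioc v₁ v₂)).prod (stdGaussianPi d)) atTop
      (𝓝 (∫ p, -G p.1 (√p.1 • p.2) ∂(volume.restrict (Ioc v₁ v₂)).prod (stdGaussianPi d))) := by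
    refine tendsto_integral_of_dominated_convergence (fun p =>
      C * (1 + 1 / √v₁ * B + d * B) * Real.exp ((κ * √S + 1) * ∑ l, |p.2 l|)) (fun n => ?_)
      (((integrable_exp_sum_abs d (κ * √S + 1)).const_mul _).comp_snd _) (fun n => ?_)
      (ae_of_all _ fun p => ?_)
    · exact aestronglyMeasurable_Ioc_prod (H.continuousOn_cutoffRemainder (hcut n) hv₁ hv₂)
    · filter_upwards [ae_mem_Ioc_prod v₁ v₂] with p hp
      exact H.abs_cutoffRemainder_le (hcut n) hv₁ hv₂ hp p.2
    · have l1 := ((hone (√p.1 • p.2)).mul_const (G p.1 (√p.1 • p.2))).neg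
      have l2 := (tendsto_finsetSum Finset.univ fun j _ =>
        ((hone₁ j (√p.1 • p.2)).const_mul (U p.1 (√p.1 • p.2))).const_mul (p.2 j)).const_mul
          (1 / √p.1)
      have l3 := (tendsto_finsetSum Finset.univ fun j _ =>
        (hone₂ j (√p.1 • p.2)).const_mul (U p.1 (√p.1 • p.2))).const_mul (1 / 2)
      simpa [cutoffRemainder] using (l1.add l2).sub l3
  have hL := (hlim v₂ (right_mem_Icc.2 hv)).sub (hlim v₁ (left_mem_Icc.2 hv))
  have heq := tendsto_nhds_unique hL (hR.congr fun n =>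
    (H.integral_cutoff_sub (hcut n) hv₁ hv hv₂).symm)
  rw [heq, integral_neg, intervalIntegral.integral_of_le hv]
  congr 1
  refine integral_prod _ (integrable_prod_of_bound (A := C) (κ := κ * √S)
    (continuousOn_comp_sqrt_smul H.contG hI) fun v hv z => ?_)
  exact abs_comp_sqrt_smul_le H.nonneg_κ H.nonneg_C H.boundG (hI (Ioc_subset_Icc_self hv)) z

theorem continuousOn_integral_source :
    ContinuousOn (fun v => ∫ z, G v (√v • z) ∂stdGaussianPi d) (Icc 0 S) :=
  continuousOn_integral_comp_sqrt_smul H.nonneg_κ H.nonneg_C H.contG H.boundG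

/-- The Feynman-Kac formula for the heat equation. -/
theorem eq_integral_add (hS : 0 ≤ S) :
    U 0 0 = (∫ z, U S (√S • z) ∂stdGaussianPi d)
      + ∫ v in 0..S, ∫ z, G v (√v • z) ∂stdGaussianPi d := by
  -- At `v = 0` the Gaussian collapses to the point `0`.
  have h0 : ∫ z, U 0 (√0 • z) ∂stdGaussianPi d = U 0 0 := by simp
  rcases hS.eq_or_lt with rfl | hS
  · simp
  have hN := H.continuousOn_integral_source
  have hM := continuousOn_integral_comp_sqrt_smul H.nonneg_κ H.nonneg_C H.cont H.bound
  set N : ℝ → ℝ := fun v => ∫ z, G v (√v • z) ∂stdGaussianPi d with hNdef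
  set M : ℝ → ℝ := fun v => ∫ z, U v (√v • z) ∂stdGaussianPi d with hMdef
  have hNi : ∀ {a b}, a ∈ Icc 0 S → b ∈ Icc 0 S → IntervalIntegrable N volume a b :=
    fun ha hb => (hN.mono (uIcc_subset_Icc ha hb)).intervalIntegrable
  have hz : (0 : ℝ) ∈ Icc 0 S := left_mem_Icc.2 hS.le
  -- This function is constant on the open interval, hence by continuity on its closure; its values
  -- at `0` and `S` are the two sides of the claim.
  have hcont : ContinuousOn (fun v => M v + ∫ u in 0..v, N u) (Icc 0 S) := by
    refine hM.add ?_
    have := intervalIntegral.continuousOn_primitive_interval (μ := volume) (f := N) (a := 0)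
      (b := S) (by
        rw [uIcc_of_le hS.le]
        exact hN.integrableOn_Icc)
    rwa [uIcc_of_le hS.le] at this
  have hmid : S / 2 ∈ Ioo 0 S := ⟨by linarith, by linarith⟩
  have hconst : EqOn (fun v => M v + ∫ u in 0..v, N u)
      (fun _ => M (S / 2) + ∫ u in 0..(S / 2), N u) (Ioo 0 S) := by
    have key : ∀ a ∈ Ioo 0 S, ∀ b ∈ Ioo 0 S, a ≤ b →
        M a + ∫ u in 0..a, N u = M b + ∫ u in 0..b, N u := by
      intro a ha b hb hab
      have h1 : M b - M a = -∫ v in a..b, N v := H.integral_sub_integral ha.1 hab hb.2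
      have h2 := intervalIntegral.integral_add_adjacent_intervals
        (hNi hz (Ioo_subset_Icc_self ha)) (hNi (Ioo_subset_Icc_self ha) (Ioo_subset_Icc_self hb))
      linarith
    intro v hv
    rcases le_total v (S / 2) with hle | hle
    · exact key v hv _ hmid hle
    · exact (key _ hmid v hv hle).symm
  have hcl := hconst.of_subset_closure hcont continuousOn_const Ioo_subset_Icc_self
    (closure_Ioo hS.ne).superset
  have e1 := hcl hz
  have e2 := hcl (right_mem_Icc.2 hS.le)
  simp only [intervalIntegral.integral_same, add_zero] at e1 e2
  rw [← h0]
  exact e1.trans e2.symm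

end IsHeatData

/-! ### Geometric Brownian motion and the lognormal density -/

theorem brownianIncrement_eq_map (d : ℕ) {v : ℝ} (hv : 0 ≤ v) :
    Market.brownianIncrement d v = (stdGaussianPi d).map fun z => √v • z := by
  unfold Market.brownianIncrement stdGaussianPi
  have h := Measure.pi_map_pi (μ := fun _ : Fin d => gaussianReal 0 1)
    (f := fun _ : Fin d => fun x : ℝ => √v * x)
    (hμ := fun _ => by rw [gaussianReal_map_const_mul]; infer_instance) (fun _ => by fun_prop)
  have e : (fun z : Fin d → ℝ => √v • z) = fun x i => √v * x i := rfl
  rw [e, h]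
  congr with i : 1
  rw [gaussianReal_map_const_mul]
  congr 1
  · simp
  · ext
    simp [Real.sq_sqrt hv, hv]

theorem sqrt_pow_eq {x : ℝ} (hx : 0 ≤ x) (n : ℕ) : √(x ^ n) = √x ^ n := by
  rw [← Real.sqrt_sq (pow_nonneg (Real.sqrt_nonneg x) n), ← pow_mul, mul_comm n 2, pow_mul,
    Real.sq_sqrt hx]

theorem isOpen_orthant (d : ℕ) : IsOpen (orthant d) := by
  have : orthant d = ⋂ l, {s : Fin d → ℝ | 0 < s l} := by ext; simp [orthant]
  rw [this]
  exact isOpen_iInter_of_finite fun l => isOpen_lt continuous_const (continuous_apply l)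

namespace Market

variable {d k : ℕ} (M : Market d k)

theorem gbm_mem_orthant (i : Fin k) (v : ℝ) {s : Fin d → ℝ} (hs : s ∈ orthant d)
    (w : Fin d → ℝ) : M.gbm i v s w ∈ orthant d :=
  fun l => mul_pos (hs l) (Real.exp_pos _)

theorem continuous_gbm (i : Fin k) (s : Fin d → ℝ) :
    Continuous fun p : ℝ × (Fin d → ℝ) => M.gbm i p.1 s p.2 := by
  unfold gbm
  fun_prop

/-- The drift in the exponent is at most `|b l| * S`, and the noise at most `m * ∑ |w j|` with `m`
the sum of all `|σ l j|`. Linear growth in price thus becomes exponential growth in `w`, uniformly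
in time. -/
theorem exists_gbm_growth (i : Fin k) {s : Fin d → ℝ} (hs : s ∈ orthant d) (S : ℝ) :
    ∃ A κ : ℝ, 0 ≤ A ∧ 0 ≤ κ ∧ ∀ v ∈ Icc 0 S, ∀ w,
      1 + ∑ l, |M.gbm i v s w l| ≤ A * Real.exp (κ * ∑ l, |w l|) := by
  let b : Fin d → ℝ := fun l => M.r i - (1 / 2) * M.a i l l
  obtain ⟨m, hmdef⟩ : ∃ m : ℝ, m = ∑ l, ∑ j, |M.σ i l j| := ⟨_, rfl⟩
  have hm : 0 ≤ m := hmdef ▸ Finset.sum_nonneg fun _ _ => Finset.sum_nonneg fun _ _ => abs_nonneg _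
  refine ⟨1 + ∑ l, s l * Real.exp (|b l| * S), m,
    add_nonneg zero_le_one (Finset.sum_nonneg fun l _ =>
      mul_nonneg (hs l).le (Real.exp_pos _).le), hm, fun v hv w => ?_⟩
  have hw : 0 ≤ ∑ l, |w l| := Finset.sum_nonneg fun _ _ => abs_nonneg _
  rw [add_mul, one_mul, Finset.sum_mul]
  refine add_le_add (Real.one_le_exp (mul_nonneg hm hw)) (Finset.sum_le_sum fun l _ => ?_)
  rw [abs_of_pos (M.gbm_mem_orthant i v hs w l), gbm, mul_assoc, ← Real.exp_add]
  refine mul_le_mul_of_nonneg_left (Real.exp_le_exp.2 (add_le_add ?_ ?_)) (hs l).le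
  · calc b l * v ≤ |b l| * v := mul_le_mul_of_nonneg_right (le_abs_self _) hv.1
      _ ≤ |b l| * S := mul_le_mul_of_nonneg_left hv.2 (abs_nonneg _)
  · rw [Finset.mul_sum]
    refine Finset.sum_le_sum fun j _ => ?_
    refine (le_abs_self _).trans ?_
    rw [abs_mul]
    refine mul_le_mul_of_nonneg_right ?_ (abs_nonneg _)
    rw [hmdef]
    exact (Finset.single_le_sum (f := fun j => |M.σ i l j|) (fun _ _ => abs_nonneg _)
      (Finset.mem_univ j)).trans (Finset.single_le_sum (f := fun l => ∑ j, |M.σ i l j|)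
        (fun _ _ => Finset.sum_nonneg fun _ _ => abs_nonneg _) (Finset.mem_univ l))

theorem det_σ_ne_zero (i : Fin k) : (M.σ i).det ≠ 0 :=
  ((Matrix.isUnit_iff_isUnit_det _).1 (M.isUnit_σ i)).ne_zero

/-- The quadratic form of the lognormal density in Gaussian coordinates. -/
theorem quadForm_inv_smul_a (i : Fin k) {v : ℝ} (hv : 0 < v) (z : Fin d → ℝ) :
    ∑ l, ∑ l', (v • M.a i)⁻¹ l l' * (√v * ∑ j, M.σ i l j * z j) * (√v * ∑ j, M.σ i l' j * z j)
      = ∑ l, z l ^ 2 := by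
  have hdet := M.det_σ_ne_zero i
  have hsq : √v ≠ 0 := (Real.sqrt_pos.2 hv).ne'
  have hu : IsUnit (v • M.a i).det := by
    rw [isUnit_iff_ne_zero, Matrix.det_smul, a, Matrix.det_mul, Matrix.det_transpose]
    exact mul_ne_zero (pow_ne_zero _ hv.ne') (mul_ne_zero hdet hdet)
  have hut : IsUnit (M.σ i).transpose.det := by
    rw [Matrix.det_transpose]
    exact isUnit_iff_ne_zero.2 hdet
  -- With `y = √v σ z`, the vector `q = (√v)⁻¹ σ⁻ᵀ z` solves `(v a) q = y`, so the quadratic form is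
  -- `y · q = z · z`.
  let y : Fin d → ℝ := √v • (M.σ i).mulVec z
  let q : Fin d → ℝ := (√v)⁻¹ • ((M.σ i).transpose⁻¹).mulVec z
  have hq : (v • M.a i).mulVec q = y := by
    simp only [q, y, a]
    rw [Matrix.mulVec_smul, Matrix.smul_mulVec, Matrix.mulVec_mulVec, Matrix.mul_assoc,
      Matrix.mul_nonsing_inv _ hut, Matrix.mul_one, smul_smul, inv_mul_eq_div, Real.div_sqrt]
  have hy : ((v • M.a i)⁻¹).mulVec y = q := by
    rw [← hq, Matrix.mulVec_mulVec, Matrix.nonsing_inv_mul _ hu, Matrix.one_mulVec]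
  have h1 : dotProduct y (((v • M.a i)⁻¹).mulVec y) = dotProduct z z := by
    rw [hy]
    simp only [y, q, smul_dotProduct, dotProduct_smul, smul_smul]
    rw [inv_mul_cancel₀ hsq, one_smul, Matrix.dotProduct_mulVec, ← Matrix.mulVec_transpose,
      Matrix.transpose_nonsing_inv, Matrix.transpose_transpose, Matrix.mulVec_mulVec,
      Matrix.nonsing_inv_mul _ (isUnit_iff_ne_zero.2 hdet), Matrix.one_mulVec]
  have h2 : dotProduct z z = ∑ l, z l ^ 2 := Finset.sum_congr rfl fun l _ => (sq _).symm
  rw [← h2, ← h1]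
  simp only [dotProduct, Matrix.mulVec, y, Pi.smul_apply, smul_eq_mul]
  refine Finset.sum_congr rfl fun l _ => ?_
  rw [Finset.mul_sum Finset.univ _ (√v * ∑ j, M.σ i l j * z j)]
  exact Finset.sum_congr rfl fun l' _ => by ring

section ChangeOfVariables

variable (i : Fin k) {v : ℝ} (hv : 0 < v) {s : Fin d → ℝ} (hs : s ∈ orthant d)

include hv hs

/-- The factor before `α` is the Jacobian of `z ↦ gbm v s (√v z)`. The normalising constants match
because `det (v a) = v ^ d * (det σ) ^ 2`. -/
theorem alpha_gbm (z : Fin d → ℝ) :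
    (∏ l, M.gbm i v s (√v • z) l) * (√v ^ d * |(M.σ i).det|)
      * M.alpha (M.gbm i v s (√v • z)) s i v = stdGaussianDensity d z := by
  have hx := M.gbm_mem_orthant i v hs (√v • z)
  have hlog : ∀ l, Real.log (M.gbm i v s (√v • z) l / s l)
      - (M.r i - (1 / 2) * M.a i l l) * v = √v * ∑ j, M.σ i l j * z j := by
    intro l
    rw [gbm, mul_div_cancel_left₀ _ (hs l).ne', Real.log_exp, add_sub_cancel_left, Finset.mul_sum]
    refine Finset.sum_congr rfl fun j _ => ?_
    simp only [Pi.smul_apply, smul_eq_mul]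
    ring
  have hsqrt : √((2 * Real.pi) ^ d * (v • M.a i).det)
      = √(2 * Real.pi) ^ d * (√v ^ d * |(M.σ i).det|) := by
    rw [Matrix.det_smul, a, Matrix.det_mul, Matrix.det_transpose, Fintype.card_fin,
      Real.sqrt_mul (by positivity), Real.sqrt_mul (by positivity), Real.sqrt_mul_self_eq_abs]
    rw [sqrt_pow_eq (by positivity), sqrt_pow_eq hv.le]
  have hprod : 0 < ∏ l, M.gbm i v s (√v • z) l := Finset.prod_pos fun l _ => hx l
  have hdet : 0 < |(M.σ i).det| := abs_pos.2 (M.det_σ_ne_zero i)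
  have hsv : 0 < √v := Real.sqrt_pos.2 hv
  have hρ : stdGaussianDensity d z
      = (√(2 * Real.pi) ^ d)⁻¹ * Real.exp (-(1 / 2) * ∑ l, z l ^ 2) := by
    simp only [stdGaussianDensity, gaussianPDFReal, Finset.prod_mul_distrib, ← Real.exp_sum,
      Finset.mul_sum]
    simp [div_eq_inv_mul]
    rw [← inv_pow, mul_inv, mul_comm]
  simp only [alpha, hlog, hsqrt]
  rw [M.quadForm_inv_smul_a i hv, hρ]
  field_simp

theorem image_gbm : (fun z => M.gbm i v s (√v • z)) '' univ = orthant d := by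
  refine Subset.antisymm ?_ fun x hx => ?_
  · rintro _ ⟨z, -, rfl⟩
    exact M.gbm_mem_orthant i v hs _
  · have hσ := isUnit_iff_ne_zero.2 (M.det_σ_ne_zero i)
    let y : Fin d → ℝ := fun l => Real.log (x l / s l) - (M.r i - (1 / 2) * M.a i l l) * v
    refine ⟨(√v)⁻¹ • ((M.σ i)⁻¹).mulVec y, mem_univ _, ?_⟩
    have h1 : (M.σ i).mulVec (((M.σ i)⁻¹).mulVec y) = y := by
      rw [Matrix.mulVec_mulVec, Matrix.mul_nonsing_inv _ hσ, Matrix.one_mulVec]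
    funext l
    have h2 : ∑ j, M.σ i l j * (((M.σ i)⁻¹).mulVec y) j = y l := congrFun h1 l
    simp only [gbm]
    rw [smul_smul, mul_inv_cancel₀ (Real.sqrt_pos.2 hv).ne', one_smul, h2, add_sub_cancel,
      Real.exp_log (div_pos (hx l) (hs l)), mul_div_cancel₀ _ (hs l).ne']

theorem injective_gbm : Function.Injective fun z => M.gbm i v s (√v • z) := by
  intro z z' h
  have hσ := isUnit_iff_ne_zero.2 (M.det_σ_ne_zero i)
  have h1 : (M.σ i).mulVec (√v • z) = (M.σ i).mulVec (√v • z') := by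
    funext l
    have h2 := mul_left_cancel₀ (hs l).ne' (congrFun h l)
    exact add_left_cancel (Real.exp_injective h2)
  have h3 := congrArg ((M.σ i)⁻¹).mulVec h1
  rw [Matrix.mulVec_mulVec, Matrix.mulVec_mulVec, Matrix.nonsing_inv_mul _ hσ, Matrix.one_mulVec,
    Matrix.one_mulVec] at h3
  exact smul_right_injective _ (Real.sqrt_pos.2 hv).ne' h3

/-- The Jacobian of `z ↦ gbm (√v z)`. -/
def gbmDeriv (M : Market d k) (i : Fin k) (v : ℝ) (s z : Fin d → ℝ) :
    (Fin d → ℝ) →L[ℝ] (Fin d → ℝ) :=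
  (Matrix.toLin' (Matrix.diagonal (M.gbm i v s (√v • z)) * (√v • M.σ i))).toContinuousLinearMap

omit hv hs in
theorem hasFDerivAt_gbm (z : Fin d → ℝ) :
    HasFDerivAt (fun z => M.gbm i v s (√v • z)) (M.gbmDeriv i v s z) z := by
  rw [hasFDerivAt_pi']
  intro l
  have h1 : HasFDerivAt (fun z : Fin d → ℝ => ∑ j, M.σ i l j * (√v • z) j)
      (∑ j, M.σ i l j • √v •
        (ContinuousLinearMap.proj j : (Fin d → ℝ) →L[ℝ] ℝ) : (Fin d → ℝ) →L[ℝ] ℝ) z :=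
    HasFDerivAt.fun_sum fun j _ => by
      have h2 : HasFDerivAt (fun z : Fin d → ℝ => z j)
        (ContinuousLinearMap.proj (R := ℝ) (φ := fun _ : Fin d => ℝ) j) z := hasFDerivAt_apply j z
      exact (h2.const_smul (√v)).const_mul _
  refine (((h1.const_add ((M.r i - (1 / 2) * M.a i l l) * v)).exp).const_mul
    (s l)).congr_fderiv ?_
  ext y
  simp [gbmDeriv, gbm, Matrix.mulVec, dotProduct, Matrix.diagonal_mul, Finset.mul_sum]
  refine Finset.sum_congr rfl fun j _ => ?_
  ring

theorem abs_det_gbmDeriv (z : Fin d → ℝ) : |(M.gbmDeriv i v s z).det|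
    = (∏ l, M.gbm i v s (√v • z) l) * (√v ^ d * |(M.σ i).det|) := by
  have hx := M.gbm_mem_orthant i v hs (√v • z)
  rw [gbmDeriv, LinearMap.det_toContinuousLinearMap, LinearMap.det_toLin', Matrix.det_mul,
    Matrix.det_diagonal, Matrix.det_smul, abs_mul, abs_mul, Fintype.card_fin,
    abs_of_pos (Finset.prod_pos fun l _ => hx l), abs_of_nonneg (by positivity)]

/-- The lognormal density is the density of the geometric Brownian motion. -/
theorem integrableOn_mul_alpha_iff (f : (Fin d → ℝ) → ℝ) :
    IntegrableOn (fun x => f x * M.alpha x s i v) (orthant d) ↔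
      Integrable (fun z => f (M.gbm i v s (√v • z))) (stdGaussianPi d) := by
  rw [← M.image_gbm i hv hs, integrableOn_image_iff_integrableOn_abs_det_fderiv_smul volume
    MeasurableSet.univ (fun z _ => (M.hasFDerivAt_gbm i z).hasFDerivWithinAt)
    (M.injective_gbm i hv hs).injOn, integrableOn_univ, integrable_stdGaussianPi_iff]
  refine iff_of_eq (congrArg (fun g => Integrable g volume) (funext fun z => ?_))
  rw [M.abs_det_gbmDeriv i hv hs, ← M.alpha_gbm i hv hs, smul_eq_mul]
  ring

theorem integral_mul_alpha (f : (Fin d → ℝ) → ℝ) :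
    ∫ x in orthant d, f x * M.alpha x s i v
      = ∫ z, f (M.gbm i v s (√v • z)) ∂stdGaussianPi d := by
  rw [← M.image_gbm i hv hs, integral_image_eq_integral_abs_det_fderiv_smul volume
    MeasurableSet.univ (fun z _ => (M.hasFDerivAt_gbm i z).hasFDerivWithinAt)
    (M.injective_gbm i hv hs).injOn, setIntegral_univ, integral_stdGaussianPi]
  refine congrArg (fun g : (Fin d → ℝ) → ℝ => ∫ z, g z) (funext fun z => ?_)
  rw [M.abs_det_gbmDeriv i hv hs, ← M.alpha_gbm i hv hs, smul_eq_mul]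
  ring

end ChangeOfVariables

end Market

/-! ### Chain rules and growth up to the endpoints -/

section Calculus

variable {d : ℕ} {T : ℝ} {f : ℝ → (Fin d → ℝ) → ℝ}

/-- The chain rule for a `C^{1,2}` function along a curve in time and space. -/
theorem IsC12.hasDerivAt_comp (hf : IsC12 T f) {τ : ℝ → ℝ} {x : ℝ → Fin d → ℝ} {τ' u : ℝ}
    {x' : Fin d → ℝ} (hτ : HasDerivAt τ τ' u) (hx : ∀ l, HasDerivAt (fun u => x u l) (x' l) u)
    (ht : τ u ∈ Ioo 0 T) (hxu : x u ∈ orthant d) :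
    HasDerivAt (fun u => f (τ u) (x u))
      (deriv (fun r => f r (x u)) (τ u) * τ' + ∑ l, partialDeriv l (f (τ u)) (x u) * x' l) u := by
  have hopen : IsOpen (Ioo 0 T ×ˢ orthant d) := isOpen_Ioo.prod (isOpen_orthant d)
  have hmem : (τ u, x u) ∈ Ioo 0 T ×ˢ orthant d := ⟨ht, hxu⟩
  have hnhds := hopen.mem_nhds hmem
  -- Directions are indexed by `Option (Fin d)`: `none` is time and `some l` the `l`-th price.
  let e : Option (Fin d) → ℝ × (Fin d → ℝ) := fun o => o.elim (1, 0) fun l => (0, Pi.single l 1)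
  let c : Option (Fin d) → ℝ × (Fin d → ℝ) →L[ℝ] ℝ := fun o =>
    o.elim (ContinuousLinearMap.fst ℝ ℝ (Fin d → ℝ)) fun l =>
      (ContinuousLinearMap.proj l : (Fin d → ℝ) →L[ℝ] ℝ).comp
        (ContinuousLinearMap.snd ℝ ℝ (Fin d → ℝ))
  let D : Option (Fin d) → ℝ × (Fin d → ℝ) → ℝ := fun o p =>
    o.elim (deriv (fun r => f r p.2) p.1) fun l => partialDeriv l (f p.1) p.2
  have hec : ∀ p, ∑ o, c o p • e o = p := by
    intro p
    rw [Fintype.sum_option]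
    ext l
    · simp [c, e, Prod.fst_sum]
    · simp [c, e, Prod.snd_sum, Finset.sum_apply, Pi.single_apply]
  have hF : HasFDerivAt (fun p : ℝ × (Fin d → ℝ) => f p.1 p.2) (∑ o, D o (τ u, x u) • c o)
      (τ u, x u) := by
    refine hasFDerivAt_of_continuousAt_lineDeriv e c hec (fun o => ?_) fun o => ?_
    · filter_upwards [hnhds] with p hp
      cases o with
      | none =>
        have h1 := (hf.diff_t p.1 hp.1 p.2 hp.2).hasDerivAt
        have h2 : HasDerivAt (fun h : ℝ => p.1 + h) 1 0 := by
          simpa using (hasDerivAt_id (0 : ℝ)).const_add p.1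
        have h3 := HasDerivAt.comp_of_eq (0 : ℝ) h1 h2 (by simp)
        have h4 : HasDerivAt (fun h : ℝ => f (p + h • ((1 : ℝ), (0 : Fin d → ℝ))).1
            (p + h • ((1 : ℝ), (0 : Fin d → ℝ))).2) (deriv (fun r => f r p.2) p.1) 0 := by
          simpa [Function.comp_def] using h3
        exact h4
      | some l =>
        have h1 : HasDerivAt (fun h : ℝ => f p.1 (p.2 + h • Pi.single l 1))
          (partialDeriv l (f p.1) p.2) 0 := (hf.diff_s p.1 hp.1 p.2 hp.2 l).hasLineDerivAt
        have h4 : HasDerivAt (fun h : ℝ => f (p + h • ((0 : ℝ), (Pi.single l 1 : Fin d → ℝ))).1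
            (p + h • ((0 : ℝ), (Pi.single l 1 : Fin d → ℝ))).2)
            (partialDeriv l (f p.1) p.2) 0 := by
          simpa using h1
        exact h4
    · cases o with
      | none => exact hf.cont_t.continuousAt hnhds
      | some l => exact (hf.cont_s l).continuousAt hnhds
  have hcurve : HasDerivAt (fun u => (τ u, x u)) (τ', x') u := hτ.prodMk (hasDerivAt_pi.2 hx)
  refine (hF.comp_hasDerivAt u hcurve).congr_deriv ?_
  rw [Fintype.sum_option]
  simp [D, c]

/-- Time is frozen, since `C^{1,2}` gives no mixed derivative in time and space. -/
theorem IsC12.hasDerivAt_partialDeriv_comp (hf : IsC12 T f) {t : ℝ} (ht : t ∈ Ioo 0 T)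
    {x : ℝ → Fin d → ℝ} {u : ℝ} {x' : Fin d → ℝ} (hx : ∀ l, HasDerivAt (fun u => x u l) (x' l) u)
    (hxu : x u ∈ orthant d) (l' : Fin d) :
    HasDerivAt (fun u => partialDeriv l' (f t) (x u))
      (∑ l, partialDeriv l (partialDeriv l' (f t)) (x u) * x' l) u := by
  have hnhds := (isOpen_orthant d).mem_nhds hxu
  have hF := hasFDerivAt_of_continuousAt_lineDeriv (f := partialDeriv l' (f t))
    (f' := fun l => partialDeriv l (partialDeriv l' (f t))) (x := x u)
    (fun l => (Pi.single l 1 : Fin d → ℝ))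
    (fun l => (ContinuousLinearMap.proj l : (Fin d → ℝ) →L[ℝ] ℝ))
    (fun y => by ext l; simp [Finset.sum_apply, Pi.single_apply])
    (fun l => by
      filter_upwards [hnhds] with y hy
      exact (hf.diff_ss t ht y hy l l').hasLineDerivAt)
    (fun l => ContinuousOn.continuousAt ((hf.cont_ss l l').comp
      (f := fun y : Fin d → ℝ => (t, y)) (by fun_prop) fun y hy => ⟨ht, hy⟩) hnhds)
  refine (hF.comp_hasDerivAt u (hasDerivAt_pi.2 hx)).congr_deriv ?_
  simp

/-- Growth is assumed only at interior times; `J` lies in the closure of `(0, T)`, so continuity in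
time carries the bound to the endpoints, in particular to the terminal value. -/
theorem LinearGrowth.of_continuousOn {J : Set ℝ} (hT : 0 < T)
    (hJ : J = Ioc 0 T ∨ J = Icc 0 T)
    (hc : ContinuousOn (fun p : ℝ × (Fin d → ℝ) => f p.1 p.2) (J ×ˢ orthant d))
    (hg : LinearGrowth T f) :
    ∃ C, 0 ≤ C ∧ ∀ t ∈ J, ∀ s ∈ orthant d, |f t s| ≤ C * (1 + ∑ l, |s l|) := by
  obtain ⟨C, hC⟩ := hg
  have hsub : Ioo 0 T ⊆ J := by
    rcases hJ with rfl | rfl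
    · exact Ioo_subset_Ioc_self
    · exact Ioo_subset_Icc_self
  have hcl : J ⊆ closure (Ioo 0 T) := by
    rw [closure_Ioo hT.ne]
    rcases hJ with rfl | rfl
    · exact Ioc_subset_Icc_self
    · exact subset_rfl
  have hmain : ∀ t ∈ J, ∀ s ∈ orthant d, |f t s| ≤ C * (1 + ∑ l, |s l|) := by
    intro t ht s hs
    have h1 : ContinuousOn (fun t => |f t s|) J :=
      (hc.comp (f := fun t : ℝ => (t, s)) (by fun_prop) fun t ht => ⟨ht, hs⟩).abs
    exact ContinuousWithinAt.closure_le (hcl ht) ((h1 t ht).mono hsub)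
      continuousWithinAt_const fun y hy => hC y hy s hs
  refine ⟨max C 0, le_max_right _ _, fun t ht s hs => (hmain t ht s hs).trans ?_⟩
  exact mul_le_mul_of_nonneg_right (le_max_left _ _) (by positivity)

end Calculus

/-! ### Reduction of a single regime to the heat equation -/

namespace Market

variable {d k : ℕ} (M : Market d k)

section Transform

variable (i : Fin k) (c t : ℝ) (s : Fin d → ℝ) (f : ℝ → (Fin d → ℝ) → ℝ)

/-- The function `f`, discounted at rate `c`, in Brownian coordinates. -/
def pullback (v : ℝ) (w : Fin d → ℝ) : ℝ := Real.exp (-c * v) * f (t + v) (M.gbm i v s w)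

/-- The first derivatives of `pullback`. -/
def pullback₁ (j : Fin d) (v : ℝ) (w : Fin d → ℝ) : ℝ :=
  Real.exp (-c * v) * ∑ l, partialDeriv l (f (t + v)) (M.gbm i v s w)
    * (M.σ i l j * M.gbm i v s w l)

/-- The pure second derivatives of `pullback`. -/
def pullback₂ (j : Fin d) (v : ℝ) (w : Fin d → ℝ) : ℝ :=
  Real.exp (-c * v) * ∑ l,
    ((∑ l', partialDeriv l' (partialDeriv l (f (t + v))) (M.gbm i v s w)
        * (M.σ i l' j * M.gbm i v s w l')) * (M.σ i l j * M.gbm i v s w l)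
      + partialDeriv l (f (t + v)) (M.gbm i v s w)
        * (M.σ i l j * (M.σ i l j * M.gbm i v s w l)))

end Transform

theorem hasDerivAt_gbm_line (i : Fin k) (v : ℝ) (s w : Fin d → ℝ) (j l : Fin d) :
    HasDerivAt (fun h : ℝ => M.gbm i v s (w + h • Pi.single j 1) l)
      (M.σ i l j * M.gbm i v s w l) 0 := by
  have h1 : HasDerivAt (fun h : ℝ => ∑ m, M.σ i l m * (w + h • (Pi.single j (1 : ℝ) : Fin d → ℝ)) m)
      (∑ m, M.σ i l m * (Pi.single j (1 : ℝ) : Fin d → ℝ) m) 0 := by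
    refine HasDerivAt.fun_sum fun m _ => HasDerivAt.const_mul _ ?_
    simpa using ((hasDerivAt_id (0 : ℝ)).mul_const
      ((Pi.single j (1 : ℝ) : Fin d → ℝ) m)).const_add (w m)
  refine (((h1.const_add ((M.r i - (1 / 2) * M.a i l l) * v)).exp).const_mul (s l)).congr_deriv ?_
  simp [gbm, Pi.single_apply]
  ring

theorem hasDerivAt_gbm_sqrt (i : Fin k) {v : ℝ} (hv : 0 < v) (s z : Fin d → ℝ) (l : Fin d) :
    HasDerivAt (fun u : ℝ => M.gbm i u s (√u • z) l)
      (M.gbm i v s (√v • z) l * (M.r i - (1 / 2) * M.a i l l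
        + (1 / (2 * √v)) * ∑ j, M.σ i l j * z j)) v := by
  have h1 : HasDerivAt (fun u : ℝ => ∑ m, M.σ i l m * (√u • z) m)
      (∑ m, M.σ i l m * (1 / (2 * √v) * z m)) v :=
    HasDerivAt.fun_sum fun m _ =>
      HasDerivAt.const_mul _ ((Real.hasDerivAt_sqrt hv.ne').mul_const (z m))
  have h2 := (hasDerivAt_id v).const_mul (M.r i - (1 / 2) * M.a i l l)
  refine (((h2.add h1).exp).const_mul (s l)).congr_deriv ?_
  have h3 : ∑ m, M.σ i l m * (1 / (2 * √v) * z m) = (1 / (2 * √v)) * ∑ j, M.σ i l j * z j := by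
    rw [Finset.mul_sum]
    exact Finset.sum_congr rfl fun m _ => by ring
  rw [h3]
  simp [gbm]
  ring

theorem sum_σ_mul_σ (i : Fin k) (l l' : Fin d) : ∑ j, M.σ i l j * M.σ i l' j = M.a i l l' := by
  simp [a, Matrix.mul_apply]

/-- Besides the diffusion operator, the Laplacian in `w` yields the first-order terms `a_ll x_l ∂_l
f`, because the coordinates are exponential. Half of these cancel the Itô drift correction. -/
theorem sum_pullback₂ (i : Fin k) (c t : ℝ) (s : Fin d → ℝ) (f : ℝ → (Fin d → ℝ) → ℝ) (v : ℝ)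
    (w : Fin d → ℝ) : ∑ j, M.pullback₂ i c t s f j v w = Real.exp (-c * v) *
      ((∑ l, ∑ l', M.a i l l' * M.gbm i v s w l * M.gbm i v s w l'
          * partialDeriv l (partialDeriv l' (f (t + v))) (M.gbm i v s w))
        + ∑ l, M.a i l l * (M.gbm i v s w l * partialDeriv l (f (t + v)) (M.gbm i v s w))) := by
  simp only [pullback₂]
  rw [← Finset.mul_sum, Finset.sum_comm]
  simp only [Finset.sum_add_distrib]
  congr 2
  · rw [Finset.sum_comm (s := Finset.univ) (t := Finset.univ) (f := fun l l' => M.a i l l' * _ * _ * _)]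
    refine Finset.sum_congr rfl fun l' _ => ?_
    simp only [Finset.sum_mul]
    rw [Finset.sum_comm]
    refine Finset.sum_congr rfl fun l _ => ?_
    rw [← sum_σ_mul_σ, Finset.sum_mul, Finset.sum_mul, Finset.sum_mul]
    exact Finset.sum_congr rfl fun j _ => by ring
  · refine Finset.sum_congr rfl fun l _ => ?_
    rw [← sum_σ_mul_σ, Finset.sum_mul]
    exact Finset.sum_congr rfl fun j _ => by ring

variable {M} {T : ℝ} {J : Set ℝ} {f g : ℝ → (Fin d → ℝ) → ℝ}

/-- In Brownian coordinates, a backward equation of regime `i` becomes the heat equation. -/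
theorem isHeatData_pullback (hT : 0 < T) (hJ : J = Ioc 0 T ∨ J = Icc 0 T) (i : Fin k) {c : ℝ}
    (hc : 0 ≤ c) (hf : IsClassical T J f) (hfg : LinearGrowth T f)
    (hg : ContinuousOn (fun p : ℝ × (Fin d → ℝ) => g p.1 p.2) (J ×ˢ orthant d))
    (hgg : LinearGrowth T g)
    (hpde : ∀ t ∈ Ioo 0 T, ∀ s ∈ orthant d, deriv (fun u => f u s) t + M.bsmOp i (f t) s
      + (M.r i - c) * f t s + g t s = 0) {t : ℝ} (ht : t ∈ J) {s : Fin d → ℝ}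
    (hs : s ∈ orthant d) :
    ∃ κ C, IsHeatData (T - t) κ C (M.pullback i c t s f) (M.pullback i c t s g)
      (M.pullback₁ i c t s f) (M.pullback₂ i c t s f) := by
  obtain ⟨Cf, hCf, bf⟩ := hfg.of_continuousOn hT hJ hf.cont
  obtain ⟨Cg, hCg, bg⟩ := hgg.of_continuousOn hT hJ hg
  obtain ⟨A, κ, hA, hκ, hgbm⟩ := M.exists_gbm_growth i hs (T - t)
  have ht0 : 0 ≤ t := by
    rcases hJ with rfl | rfl
    · exact ht.1.le
    · exact ht.1
  have hmemJ : ∀ v ∈ Icc 0 (T - t), t + v ∈ J := by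
    rintro v ⟨h0, h1⟩
    rcases hJ with rfl | rfl
    · exact ⟨by linarith [ht.1], by linarith⟩
    · exact ⟨by linarith [ht.1], by linarith⟩
  have hmemI : ∀ v ∈ Ioo 0 (T - t), t + v ∈ Ioo 0 T := fun v hv =>
    ⟨by linarith [hv.1], by linarith [hv.2]⟩
  have hx := fun v w => M.gbm_mem_orthant i v hs w
  have cexp : Continuous fun p : ℝ × (Fin d → ℝ) => Real.exp (-c * p.1) := by fun_prop
  have cgbm := M.continuous_gbm i s
  have cmap : Continuous fun p : ℝ × (Fin d → ℝ) => (t + p.1, M.gbm i p.1 s p.2) := by fun_prop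
  have ccoord : ∀ l, Continuous fun p : ℝ × (Fin d → ℝ) => M.gbm i p.1 s p.2 l := fun l =>
    (continuous_apply l).comp cgbm
  have contJ : ∀ {h : ℝ → (Fin d → ℝ) → ℝ},
      ContinuousOn (fun p : ℝ × (Fin d → ℝ) => h p.1 p.2) (J ×ˢ orthant d) →
      ContinuousOn (fun p : ℝ × (Fin d → ℝ) => M.pullback i c t s h p.1 p.2)
        (Icc 0 (T - t) ×ˢ univ) := fun hh =>
    cexp.continuousOn.mul (hh.comp cmap.continuousOn fun p hp => ⟨hmemJ _ hp.1, hx _ _⟩)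
  have contI : ∀ {h : ℝ × (Fin d → ℝ) → ℝ}, ContinuousOn h (Ioo 0 T ×ˢ orthant d) →
      ContinuousOn (fun p : ℝ × (Fin d → ℝ) => h (t + p.1, M.gbm i p.1 s p.2))
        (Ioo 0 (T - t) ×ˢ univ) := fun hh =>
    hh.comp cmap.continuousOn fun p hp => ⟨hmemI _ hp.1, hx _ _⟩
  have bound : ∀ {h : ℝ → (Fin d → ℝ) → ℝ} {C : ℝ}, 0 ≤ C → C ≤ Cf + Cg →
      (∀ t ∈ J, ∀ s ∈ orthant d, |h t s| ≤ C * (1 + ∑ l, |s l|)) →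
      ∀ v ∈ Icc 0 (T - t), ∀ w, |M.pullback i c t s h v w|
        ≤ (Cf + Cg) * A * Real.exp (κ * ∑ l, |w l|) := by
    intro h C hC0 hC hb v hv w
    rw [pullback, abs_mul, Real.abs_exp, mul_assoc (Cf + Cg)]
    refine (mul_le_of_le_one_left (abs_nonneg _) (Real.exp_le_one_iff.2 ?_)).trans ?_
    · rw [neg_mul]
      exact neg_nonpos.2 (mul_nonneg hc hv.1)
    · exact (hb _ (hmemJ v hv) _ (hx v w)).trans
        (mul_le_mul hC (hgbm v hv w) (by positivity) (by positivity))
  refine ⟨κ, (Cf + Cg) * A, ?_⟩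
  refine
    { cont := contJ hf.cont
      contG := contJ hg
      cont₁ := fun j => ?_
      cont₂ := fun j => ?_
      bound := bound hCf (by linarith) bf
      boundG := bound hCg (by linarith) bg
      nonneg_κ := hκ
      nonneg_C := by positivity
      deriv_t := fun v hv z => ?_
      deriv₁ := fun v hv j w => ?_
      deriv₂ := fun v hv j w => ?_ }
  · exact cexp.continuousOn.mul (continuousOn_finsetSum _ fun l _ =>
      (contI (hf.c12.cont_s l)).mul (continuousOn_const.mul (ccoord l).continuousOn))
  · exact cexp.continuousOn.mul (continuousOn_finsetSum _ fun l _ =>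
      ((continuousOn_finsetSum _ fun l' _ => (contI (hf.c12.cont_ss l' l)).mul
        (continuousOn_const.mul (ccoord l').continuousOn)).mul
          (continuousOn_const.mul (ccoord l).continuousOn)).add
      ((contI (hf.c12.cont_s l)).mul (continuousOn_const.mul
        (continuousOn_const.mul (ccoord l).continuousOn))))
  · have h1 : HasDerivAt (fun u => t + u) 1 v := by
      simpa using (hasDerivAt_id v).const_add t
    have h2 := hf.c12.hasDerivAt_comp h1 (fun l => M.hasDerivAt_gbm_sqrt i hv.1 s z l) (hmemI v hv)
      (hx v (√v • z))
    have h3 : HasDerivAt (fun u : ℝ => Real.exp (-c * u)) (Real.exp (-c * v) * -c) v := by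
      simpa using ((hasDerivAt_id v).const_mul (-c)).exp
    refine (h3.fun_mul h2).congr_deriv ?_
    -- Since `bsmOp` contains `-r f`, the equation has zeroth-order coefficient `-c`, which the
    -- derivative of `exp (-c v)` reproduces.
    have hp := hpde (t + v) (hmemI v hv) _ (hx v (√v • z))
    rw [bsmOp] at hp
    rw [sum_pullback₂]
    set x := M.gbm i v s (√v • z) with hxdef
    set p : Fin d → ℝ := fun l => partialDeriv l (f (t + v)) x with hpdef
    -- The drift splits into the interest term of the equation, the Itô correction, and the part
    -- proportional to `z`, which is the gradient term of the heat data by `e2`.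
    have e1 : ∑ l, p l * (x l * (M.r i - (1 / 2) * M.a i l l
        + (1 / (2 * √v)) * ∑ j, M.σ i l j * z j))
        = M.r i * ∑ l, x l * p l - (1 / 2) * ∑ l, M.a i l l * (x l * p l)
          + (1 / (2 * √v)) * ∑ l, p l * (x l * ∑ j, M.σ i l j * z j) := by
      simp only [Finset.mul_sum _ (fun l => x l * p l), Finset.mul_sum _ (fun l => M.a i l l * _),
        Finset.mul_sum _ (fun l => p l * _), ← Finset.sum_sub_distrib, ← Finset.sum_add_distrib]
      exact Finset.sum_congr rfl fun l _ => by ring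
    have e2 : ∑ j, z j * M.pullback₁ i c t s f j v (√v • z)
        = Real.exp (-c * v) * ∑ l, p l * (x l * ∑ j, M.σ i l j * z j) := by
      simp only [pullback₁, Finset.mul_sum]
      rw [Finset.sum_comm]
      exact Finset.sum_congr rfl fun l _ => Finset.sum_congr rfl fun j _ => by
        simp only [hpdef, hxdef]
        ring
    rw [e2]
    change Real.exp (-c * v) * -c * f (t + v) x + Real.exp (-c * v) *
      (deriv (fun r => f r x) (t + v) * 1 + ∑ l, p l * (x l * (M.r i - (1 / 2) * M.a i l l
        + (1 / (2 * √v)) * ∑ j, M.σ i l j * z j))) = _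
    rw [e1]
    simp only [pullback, ← hxdef]
    linear_combination Real.exp (-c * v) * hp
  · have h1 := hf.c12.hasDerivAt_comp (x := fun h : ℝ => M.gbm i v s (w + h • Pi.single j 1))
      (hasDerivAt_const (0 : ℝ) (t + v)) (fun l => M.hasDerivAt_gbm_line i v s w j l)
      (hmemI v hv) (hx v _)
    simp only [zero_smul, add_zero, mul_zero, zero_add] at h1
    exact h1.const_mul (Real.exp (-c * v))
  · have h1 := fun l => hf.c12.hasDerivAt_partialDeriv_comp
      (x := fun h : ℝ => M.gbm i v s (w + h • Pi.single j 1)) (hmemI v hv)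
      (fun l => M.hasDerivAt_gbm_line i v s w j l) (hx v _) l
    simp only [zero_smul, add_zero] at h1
    have h2 := HasDerivAt.fun_sum (u := Finset.univ) fun l _ => (h1 l).fun_mul
      ((M.hasDerivAt_gbm_line i v s w j l).const_mul (M.σ i l j))
    simp only [zero_smul, add_zero] at h2
    exact h2.const_mul (Real.exp (-c * v))

variable {d k : ℕ} {M : Market d k} {T : ℝ} {J : Set ℝ} {f g : ℝ → (Fin d → ℝ) → ℝ}

/-! ### Feynman-Kac formula for one regime and the integral equation -/

theorem integrable_comp_gbm (hT : 0 < T) (hJ : J = Ioc 0 T ∨ J = Icc 0 T) (i : Fin k)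
    (hg : ContinuousOn (fun p : ℝ × (Fin d → ℝ) => g p.1 p.2) (J ×ˢ orthant d))
    (hgg : LinearGrowth T g) {u v : ℝ} (hu : u ∈ J) (hv : 0 ≤ v) {s : Fin d → ℝ}
    (hs : s ∈ orthant d) :
    Integrable (fun z => g u (M.gbm i v s (√v • z))) (stdGaussianPi d) := by
  obtain ⟨C, hC, b⟩ := hgg.of_continuousOn hT hJ hg
  obtain ⟨A, κ, hA, hκ, hgbm⟩ := M.exists_gbm_growth i hs v
  have hx := fun w => M.gbm_mem_orthant i v hs w
  have hvm : v ∈ Icc 0 v := right_mem_Icc.2 hv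
  have hcont : Continuous fun w => g u (M.gbm i v s w) := by
    rw [← continuousOn_univ]
    refine hg.comp (f := fun w : Fin d → ℝ => (u, M.gbm i v s w)) ?_ fun w _ => ⟨hu, hx w⟩
    exact (continuous_const.prodMk ((M.continuous_gbm i s).comp
      (continuous_const.prodMk continuous_id))).continuousOn
  refine ((integrable_exp_sum_abs d (κ * √v)).const_mul (C * A)).mono'
    (hcont.comp (by fun_prop)).aestronglyMeasurable (ae_of_all _ fun z => ?_)
  refine abs_comp_sqrt_smul_le (F := fun _ w => g u (M.gbm i v s w)) (S := v) hκ (by positivity)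
    (fun _ _ w => (b u hu _ (hx w)).trans ?_) hvm z
  rw [mul_assoc]
  exact mul_le_mul_of_nonneg_left (hgbm v hvm w) hC

/-- The Feynman-Kac formula for the backward equation of regime `i`. -/
theorem feynmanKac (hT : 0 < T) (hJ : J = Ioc 0 T ∨ J = Icc 0 T) (i : Fin k) {c : ℝ}
    (hc : 0 ≤ c) (hf : IsClassical T J f) (hfg : LinearGrowth T f)
    (hg : ContinuousOn (fun p : ℝ × (Fin d → ℝ) => g p.1 p.2) (J ×ˢ orthant d))
    (hgg : LinearGrowth T g)
    (hpde : ∀ t ∈ Ioo 0 T, ∀ s ∈ orthant d, deriv (fun u => f u s) t + M.bsmOp i (f t) s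
      + (M.r i - c) * f t s + g t s = 0) {t : ℝ} (ht : t ∈ J) {s : Fin d → ℝ}
    (hs : s ∈ orthant d) :
    ContinuousOn (fun v => ∫ z, M.pullback i c t s g v (√v • z) ∂stdGaussianPi d)
        (Icc 0 (T - t)) ∧
      f t s = Real.exp (-c * (T - t))
          * (∫ z, f T (M.gbm i (T - t) s (√(T - t) • z)) ∂stdGaussianPi d)
        + ∫ v in 0..(T - t), ∫ z, M.pullback i c t s g v (√v • z) ∂stdGaussianPi d := by
  obtain ⟨κ, C, H⟩ := isHeatData_pullback hT hJ i hc hf hfg hg hgg hpde ht hs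
  have htT : t ≤ T := by
    rcases hJ with rfl | rfl
    · exact ht.2
    · exact ht.2
  refine ⟨H.continuousOn_integral_source, ?_⟩
  have h0 : M.pullback i c t s f 0 0 = f t s := by
    have hgbm : M.gbm i 0 s 0 = s := by
      funext l
      simp [gbm]
    simp [pullback, hgbm]
  rw [← h0, H.eq_integral_add (sub_nonneg.2 htT)]
  simp only [pullback, add_sub_cancel, integral_const_mul]

/-- The growth of `K` is read off from `g` at time `T`. -/
theorem integrable_brownianIncrement_gbm {K : (Fin d → ℝ) → ℝ} (hK : ContinuousOn K (orthant d))
    (hT : 0 < T) (hJ : J = Ioc 0 T ∨ J = Icc 0 T) (i : Fin k)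
    (hg : ContinuousOn (fun p : ℝ × (Fin d → ℝ) => g p.1 p.2) (J ×ˢ orthant d))
    (hgg : LinearGrowth T g) (hgT : ∀ s ∈ orthant d, g T s = K s) {v : ℝ} (hv : 0 ≤ v)
    {s : Fin d → ℝ} (hs : s ∈ orthant d) :
    Integrable (fun w => K (M.gbm i v s w)) (brownianIncrement d v) := by
  have hx := fun w => M.gbm_mem_orthant i v hs w
  have hTJ : T ∈ J := by
    rcases hJ with rfl | rfl
    · exact right_mem_Ioc.2 hT
    · exact right_mem_Icc.2 hT.le
  have hcont : Continuous fun w => K (M.gbm i v s w) :=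
    hK.comp_continuous ((M.continuous_gbm i s).comp (continuous_const.prodMk continuous_id)) hx
  rw [brownianIncrement_eq_map d hv, integrable_map_measure hcont.aestronglyMeasurable
    (by fun_prop)]
  refine (integrable_comp_gbm (M := M) hT hJ i hg hgg hTJ hv hs).congr (ae_of_all _ fun z => ?_)
  exact hgT _ (hx _)

theorem eta_eq {K : (Fin d → ℝ) → ℝ} (hK : ContinuousOn K (orthant d)) (i : Fin k) {t : ℝ}
    (ht : t ≤ T) {s : Fin d → ℝ} (hs : s ∈ orthant d) :
    M.eta T K i t s = Real.exp (-M.r i * (T - t))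
      * ∫ z, K (M.gbm i (T - t) s (√(T - t) • z)) ∂stdGaussianPi d := by
  have hcont : Continuous fun w => K (M.gbm i (T - t) s w) :=
    hK.comp_continuous ((M.continuous_gbm i s).comp (continuous_const.prodMk continuous_id))
      fun w => M.gbm_mem_orthant i (T - t) hs w
  rw [eta, integral_const_mul, brownianIncrement_eq_map d (sub_nonneg.2 ht),
    integral_map (by fun_prop) hcont.aestronglyMeasurable]

/-- Classical solutions of the Black-Scholes-Merton problem are unique. -/
theorem IsBSMSolution.eq_eta {K : (Fin d → ℝ) → ℝ} (hK : ContinuousOn K (orthant d))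
    (hT : 0 < T) (hJ : J = Ioc 0 T ∨ J = Icc 0 T) {i : Fin k}
    {u : ℝ → (Fin d → ℝ) → ℝ} (hu : M.IsBSMSolution T J K i u) {t : ℝ} (ht : t ∈ J)
    {s : Fin d → ℝ} (hs : s ∈ orthant d) : u t s = M.eta T K i t s := by
  have htT : t ≤ T := by
    rcases hJ with rfl | rfl
    · exact ht.2
    · exact ht.2
  have h := (feynmanKac (M := M) (g := fun _ _ => 0) hT hJ i (M.r_nonneg i) hu.classical hu.growth
    continuousOn_const ⟨0, by simp⟩ (fun t ht s hs => by simpa using hu.pde t ht s hs) ht hs).2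
  rw [h, eta_eq hK i htT hs]
  simp [pullback, fun z => hu.terminal _ (M.gbm_mem_orthant i (T - t) hs z)]

/-- A zero row sum with nonnegative off-diagonal entries forces a nonpositive diagonal. -/
theorem exitRate_eq (M : Market d k) (i : Fin k) : M.exitRate i = -M.rate i i := by
  have h := M.rate_row_sum i
  rw [← Finset.add_sum_erase _ _ (Finset.mem_univ i)] at h
  have h2 : 0 ≤ ∑ j ∈ Finset.univ.erase i, M.rate i j :=
    Finset.sum_nonneg fun j hj => M.rate_nonneg i j (Finset.ne_of_mem_erase hj).symm
  rw [exitRate, abs_of_nonpos (by linarith)]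

/-- The contribution of the other regimes to the equation of regime `i`. -/
def jumpSource (M : Market d k) (φ : ℝ → (Fin d → ℝ) → Fin k → ℝ) (i : Fin k) (t : ℝ)
    (s : Fin d → ℝ) : ℝ :=
  ∑ j ∈ Finset.univ.erase i, M.rate i j * φ t s j

theorem linearGrowth_jumpSource {φ : ℝ → (Fin d → ℝ) → Fin k → ℝ}
    (hφ : ∀ j, LinearGrowth T (fun t s => φ t s j)) (i : Fin k) :
    LinearGrowth T (M.jumpSource φ i) := by
  choose C hC using hφ
  refine ⟨∑ j ∈ Finset.univ.erase i, |M.rate i j| * C j, fun t ht s hs => ?_⟩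
  rw [Finset.sum_mul]
  refine (Finset.abs_sum_le_sum_abs _ _).trans (Finset.sum_le_sum fun j _ => ?_)
  rw [abs_mul, mul_assoc]
  exact mul_le_mul_of_nonneg_left (hC j t ht s hs) (abs_nonneg _)

theorem IsSystemSolution.solvesIE_eta {K : (Fin d → ℝ) → ℝ} (hK : ContinuousOn K (orthant d))
    (hT : 0 < T) (hJ : J = Ioc 0 T ∨ J = Icc 0 T) {φ : ℝ → (Fin d → ℝ) → Fin k → ℝ}
    (hφ : M.IsSystemSolution T J K φ) : M.SolvesIE T J (M.eta T K) φ := by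
  intro t ht s hs i
  have htT : t ≤ T := by
    rcases hJ with rfl | rfl
    · exact ht.2
    · exact ht.2
  have hmemJ : ∀ v ∈ Icc 0 (T - t), t + v ∈ J := by
    rintro v ⟨h0, h1⟩
    rcases hJ with rfl | rfl
    · exact ⟨by linarith [ht.1], by linarith⟩
    · exact ⟨by linarith [ht.1], by linarith⟩
  have hint : ∀ j, ∀ v ∈ Icc 0 (T - t),
      Integrable (fun z => φ (t + v) (M.gbm i v s (√v • z)) j) (stdGaussianPi d) := fun j v hv =>
    integrable_comp_gbm (g := fun t s => φ t s j) hT hJ i (hφ.classical j).cont (hφ.growth j)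
      (hmemJ v hv) hv.1 hs
  -- The change of variables needs `v > 0`; the excluded endpoint does not affect the time integral.
  have hjump : ∀ v ∈ Ioc 0 (T - t), M.jumpIntegrand φ t s i v
      = ∫ z, M.pullback i (M.exitRate i + M.r i) t s (M.jumpSource φ i) v (√v • z)
        ∂stdGaussianPi d := by
    intro v hv
    simp only [pullback, jumpSource, jumpIntegrand]
    rw [integral_const_mul, integral_finsetSum _ fun j _ =>
      (hint j v (Ioc_subset_Icc_self hv)).const_mul _]
    congr 1
    refine Finset.sum_congr rfl fun j _ => ?_
    rw [integral_const_mul, M.integral_mul_alpha i hv.1 hs fun x => φ (t + v) x j]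
  have hFK := feynmanKac (M := M) (f := fun t s => φ t s i) (g := M.jumpSource φ i)
    (c := M.exitRate i + M.r i) hT hJ i
    (add_nonneg (abs_nonneg _) (M.r_nonneg i)) (hφ.classical i) (hφ.growth i)
    (continuousOn_finsetSum _ fun j _ => continuousOn_const.mul (hφ.classical j).cont)
    -- Splitting off `j = i` from the coupling sum gives `-λᵢ φ`, which is `(r - c) φ` for `c = λᵢ +
    -- r(i)`; the rest is the source.
    (linearGrowth_jumpSource hφ.growth i) (fun t ht s hs => by
      have h := hφ.pde t ht s hs i
      rw [genOp, ← Finset.add_sum_erase _ _ (Finset.mem_univ i)] at h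
      rw [exitRate_eq, jumpSource]
      linarith) ht hs
  obtain ⟨hcont, heq⟩ := hFK
  refine ⟨fun v hv j _ => ?_, ?_, ?_⟩
  · exact (M.integrableOn_mul_alpha_iff i hv.1 hs fun x => φ (t + v) x j).2
      (hint j v (Ioc_subset_Icc_self hv))
  · rw [← uIcc_of_le (sub_nonneg.2 htT)] at hcont
    refine hcont.intervalIntegrable.congr fun v hv => ?_
    rw [uIoc_of_le (sub_nonneg.2 htT)] at hv
    exact (hjump v hv).symm
  · have h1 : ∫ v in 0..(T - t), M.jumpIntegrand φ t s i v = ∫ v in 0..(T - t),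
        ∫ z, M.pullback i (M.exitRate i + M.r i) t s (M.jumpSource φ i) v (√v • z)
          ∂stdGaussianPi d := by
      rw [intervalIntegral.integral_of_le (sub_nonneg.2 htT),
        intervalIntegral.integral_of_le (sub_nonneg.2 htT)]
      exact setIntegral_congr_fun measurableSet_Ioc hjump
    rw [h1, heq, eta_eq hK i htT hs, ← mul_assoc, ← Real.exp_add]
    simp only [fun z => hφ.terminal _ (M.gbm_mem_orthant i (T - t) hs z) i]
    ring_nf

end Market

end RegimeSwitching

end

/-! ### The proposition -/

theorem propositionB2 {d k : ℕ} (M : RegimeSwitching.Market d k)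
    (T : ℝ) (hT : 0 < T)
    (J : Set ℝ) (hJ : J = Set.Ioc 0 T ∨ J = Set.Icc 0 T)
    (K : (Fin d → ℝ) → ℝ)
    (hK_nonneg : ∀ s ∈ RegimeSwitching.orthant d, 0 ≤ K s)
    (hK_lip : ∃ L, LipschitzOnWith L K (RegimeSwitching.orthant d))
    (φ : ℝ → (Fin d → ℝ) → Fin k → ℝ)
    (hφ : M.IsSystemSolution T J K φ) :
    (∀ i, ∀ t ∈ J, ∀ s ∈ RegimeSwitching.orthant d,
      MeasureTheory.Integrable (fun w => K (M.gbm i (T - t) s w))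
        (RegimeSwitching.Market.brownianIncrement d (T - t))) ∧
    M.SolvesIE T J (M.eta T K) φ ∧
    ∀ η : Fin k → ℝ → (Fin d → ℝ) → ℝ,
      (∀ i, M.IsBSMSolution T J K i (η i)) → M.SolvesIE T J η φ := by
  obtain ⟨L, hL⟩ := hK_lip
  have hK := hL.continuousOn
  have hIE := hφ.solvesIE_eta hK hT hJ
  refine ⟨fun i t ht s hs => ?_, hIE, fun η hη t ht s hs i => ?_⟩
  · have htT : t ≤ T := by
      rcases hJ with rfl | rfl
      · exact ht.2
      · exact ht.2
    exact RegimeSwitching.Market.integrable_brownianIncrement_gbm hK hT hJ i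
      (hφ.classical i).cont (hφ.growth i) (fun s hs => hφ.terminal s hs i) (sub_nonneg.2 htT) hs
  -- By uniqueness `η i` agrees with `eta` on `J`, and (IE) involves `η i` only at the point `(t,
  -- s)`.
  · rw [(hη i).eq_eta hK hT hJ ht hs]
    exact hIE t ht s hs i
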